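/- Let $m,n\ge 1$, let $A\in\mathbb R^{n\times n}$ and $C_i\in\mathbb R^{s_i\times n}$ $(i=1,\dots,m)$, and consider the system $\dot x=Ax$, $y_i=C_ix$, which is assumed to be jointly observable, i.e. $(C,A)$ with $C=[C_1'\ \cdots\ C_m']'$ is observable. Let $\mathcal V_i$ be the unobservable space of $(C_i,A)$ and $P_i$ the orthogonal projection of $\mathbb R^n$ on $\mathcal V_i$. A neighbor graph is a function $\mathbb N$ from $[0,\infty)$ to the directed graphs on $\{1,\dots,m\}$ that have a self-arc at every vertex; $\mathcal N_i(t)=\{j:\ (j,i)\text{ is an arc of }\mathbb N(t)\}$ and $m_i(t)=|\mathcal N_i(t)|$. It is said to switch among strongly connected graphs with average dwell time $\tau_D>0$ and chatter bound $\delta_0$ if every $\mathbb N(t)$ is strongly connected, $\mathbb N$ is piecewise constant, and for all $0\le t_0\le t$ the number of its discontinuities in $(t_0,t)$ is at most $\delta_0+\frac{t-t_0}{\tau_D}$. For matrices $K_i\in\mathbb R^{n\times s_i}$ and a gain $g>0$ consider the estimator $$\dot x_i=(A+K_iC_i)x_i-K_iy_i-gP_i\Big(x_i-\frac1{m_i(t)}\sum_{j\in\mathcal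 N_i(t)}x_j\Big),\qquad i=1,\dots,m.$$ Let $\lambda>0$. Call $K_i$ admissible if it arises as follows: $Q_i$ is a full row rank matrix with kernel $\mathcal V_i$, $\bar C_i$ and $\bar A_i$ are the solutions of $\bar C_iQ_i=C_i$ and $Q_iA=\bar A_iQ_i$, $\bar K_i$ is a matrix for which $e^{(\bar A_i+\bar K_i\bar C_i)t}=O(e^{-\lambda t})$ as $t\to\infty$, and $K_i=Q_i^{-1}\bar K_i$ for a right inverse $Q_i^{-1}$ of $Q_i$. **Theorem.** Fix $\tau_D>0$ and $\lambda>0$. Admissible matrices $K_1,\dots,K_m$ exist, and there is a number $g^*>0$ with the following property. For every $g\ge g^*$, every $\delta_0$, every neighbor graph $\mathbb N$ switching among strongly connected graphs with average dwell time $\tau_D$ and chatter bound $\delta_0$, every choice of admissible $K_1,\dots,K_m$, every solution $x$ of the system and every solution $x_1,\dots,x_m$ of the estimator (with arbitrary initial states), each estimation error $e_i=x_i-x$ converges to zero as fast as $e^{-\lambda t}$, i.e. $\|x_i(t)-x(t)\|=O(e^{-\lambda t})$ as $t\to\infty$. -/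

import Mathlib

open Filter Topology Asymptotics Matrix

namespace DistEst

noncomputable section

/-! Linear systems `ẋ = A x`, `y = C x`. -/

/-- The observability matrix of `(C, A)`: the blocks `C, C A, …, C A^(n-1)` stacked. -/
def observabilityMatrix {n : ℕ} {p : Type*} (C : Matrix p (Fin n) ℝ)
    (A : Matrix (Fin n) (Fin n) ℝ) : Matrix (Fin n × p) (Fin n) ℝ :=
  Matrix.of fun ka b => (C * A ^ (ka.1 : ℕ)) ka.2 b

/-- The unobservable space of `(C, A)`: the kernel of the observability matrix. -/
def unobservableSpace {n : ℕ} {p : Type*} [Fintype p] (C : Matrix p (Fin n) ℝ)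
    (A : Matrix (Fin n) (Fin n) ℝ) : Submodule ℝ (EuclideanSpace ℝ (Fin n)) :=
  LinearMap.ker (Matrix.toEuclideanLin (observabilityMatrix C A))

/-- `(C, A)` is observable: the observability matrix has rank `n`. -/
def IsObservable {n : ℕ} {p : Type*} [Fintype p] (C : Matrix p (Fin n) ℝ)
    (A : Matrix (Fin n) (Fin n) ℝ) : Prop :=
  (observabilityMatrix C A).rank = n

/-- The matrix obtained by stacking `C 1, …, C m`. -/
def stack {m n : ℕ} {s : Fin m → ℕ} (C : ∀ i, Matrix (Fin (s i)) (Fin n) ℝ) :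
    Matrix (Σ i, Fin (s i)) (Fin n) ℝ :=
  Matrix.of fun ia b => C ia.1 ia.2 b

/-- The system with outputs `y i = C i x` is jointly observable. -/
def IsJointlyObservable {m n : ℕ} {s : Fin m → ℕ}
    (C : ∀ i, Matrix (Fin (s i)) (Fin n) ℝ) (A : Matrix (Fin n) (Fin n) ℝ) : Prop :=
  IsObservable (stack C) A

/-- `e^(M t)` converges to zero (entrywise) as fast as `e^(-λ t)`. -/
def ExpDecaysAtRate {r : ℕ} (M : Matrix (Fin r) (Fin r) ℝ) (lam : ℝ) : Prop :=
  ∀ a b, (fun t : ℝ => NormedSpace.exp (t • M) a b) =O[atTop] fun t => Real.exp (-lam * t)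

/-- `K` is an output injection gain for the observable part of `(C, A)` with rate `lam`.
`Q` is a full-rank matrix whose kernel is the unobservable space, `Cb Q = C`, `Q A = Ab Q`,
`Kb` makes `e^((Ab + Kb Cb) t)` decay as fast as `e^(-lam t)`, and `K = R Kb` with `R` a right
inverse of `Q`. -/
def IsLocalGain {n p : ℕ} (C : Matrix (Fin p) (Fin n) ℝ) (A : Matrix (Fin n) (Fin n) ℝ)
    (lam : ℝ) (K : Matrix (Fin n) (Fin p) ℝ) : Prop :=
  ∃ (r : ℕ) (Q : Matrix (Fin r) (Fin n) ℝ) (Cb : Matrix (Fin p) (Fin r) ℝ)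
    (Ab : Matrix (Fin r) (Fin r) ℝ) (Kb : Matrix (Fin r) (Fin p) ℝ)
    (R : Matrix (Fin n) (Fin r) ℝ),
    Q.rank = r ∧
    LinearMap.ker (Matrix.toEuclideanLin Q) = unobservableSpace C A ∧
    Cb * Q = C ∧
    Q * A = Ab * Q ∧
    ExpDecaysAtRate (Ab + Kb * Cb) lam ∧
    Q * R = 1 ∧
    K = R * Kb

/-! Time-varying neighbor graphs. -/

/-- There is a self-arc at each vertex and a directed path from each vertex to each vertex. -/
def IsSelfArcedStronglyConnected {m : ℕ} (G : Digraph (Fin m)) : Prop :=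
  (∀ i, G.Adj i i) ∧ ∀ i j, Relation.ReflTransGen G.Adj i j

/-- `t` is a discontinuity of the signal `N`, where `N` takes values in a finite (discrete) set. -/
def IsDiscontinuity {α : Type*} (N : ℝ → α) (t : ℝ) : Prop :=
  ¬ ∀ᶠ s in 𝓝 t, N s = N t

/-- The discontinuities of `N` in the open interval `(t₀, t)`. -/
def discontinuities {α : Type*} (N : ℝ → α) (t₀ t : ℝ) : Set ℝ :=
  {s | s ∈ Set.Ioo t₀ t ∧ IsDiscontinuity N s}

/-- The neighbor graphs on `[0, ∞)` (values at negative times are irrelevant) that switch, in a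
piecewise constant way, among the strongly connected graphs with self-arcs at all vertices, with
average dwell time `τD` and chatter bound `δ₀`. -/
def IsAvgDwellNeighborGraph {m : ℕ} (τD δ₀ : ℝ) (N : ℝ → Digraph (Fin m)) : Prop :=
  (∀ t, 0 ≤ t → IsSelfArcedStronglyConnected (N t)) ∧
  ∀ t₀ t, 0 ≤ t₀ → t₀ ≤ t →
    (discontinuities N t₀ t).Finite ∧
    ((discontinuities N t₀ t).ncard : ℝ) ≤ δ₀ + (t - t₀) / τD

open scoped Classical in
/-- The labels of the neighbors of `i`: those `j` with an arc from `j` to `i`. -/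
def neighbors {m : ℕ} (G : Digraph (Fin m)) (i : Fin m) : Finset (Fin m) :=
  Finset.univ.filter fun j => G.Adj j i

/-! The plant and the estimator. -/

/-- `x` solves `ẋ = A x` on `[0, ∞)`. -/
def IsPlantTrajectory {n : ℕ} (A : Matrix (Fin n) (Fin n) ℝ)
    (x : ℝ → EuclideanSpace ℝ (Fin n)) : Prop :=
  ContinuousOn x (Set.Ici 0) ∧
  ∀ t, 0 < t → HasDerivAt x (Matrix.toEuclideanLin A (x t)) t

/-- `xh 1, …, xh m` solve the estimator equations
`ẋᵢ = (A + Kᵢ Cᵢ) xᵢ - Kᵢ yᵢ - g Pᵢ (xᵢ - (1 / mᵢ(t)) ∑_{j ∈ Nᵢ(t)} xⱼ)` on `[0, ∞)`: they are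
continuous and satisfy the equations at all `t > 0` except the discontinuities of `N`. Here `Pᵢ` is
the orthogonal projection on the unobservable space of `(Cᵢ, A)`. -/
def IsEstimatorTrajectory {m n : ℕ} {s : Fin m → ℕ} (A : Matrix (Fin n) (Fin n) ℝ)
    (C : ∀ i, Matrix (Fin (s i)) (Fin n) ℝ) (K : ∀ i, Matrix (Fin n) (Fin (s i)) ℝ) (g : ℝ)
    (N : ℝ → Digraph (Fin m)) (y : ∀ i, ℝ → EuclideanSpace ℝ (Fin (s i)))
    (xh : Fin m → ℝ → EuclideanSpace ℝ (Fin n)) : Prop :=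
  ∀ i, ContinuousOn (xh i) (Set.Ici 0) ∧
    ∀ t, 0 < t → ¬ IsDiscontinuity N t →
      HasDerivAt (xh i)
        (Matrix.toEuclideanLin (A + K i * C i) (xh i t) - Matrix.toEuclideanLin (K i) (y i t)
          - g • (unobservableSpace (C i) A).starProjection
              (xh i t - ((neighbors (N t) i).card : ℝ)⁻¹ • ∑ j ∈ neighbors (N t) i, xh j t)) t

end

end DistEst

/-! Split each error as `e i = z i + w i`, where `z i` is its projection on the unobservable space
`V i`. The coupling term lies in `V i`, so modulo `V i` the error obeys an autonomous equation, and
`w i` decays at rate `lam` whatever the graph does (`IsLocalGain.exists_bound`). Suitable gains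
exist by a Gramian argument on the observable quotient (`exists_outputInjection`).

The `z i` satisfy a coupled equation forced by the `w j`. For a fixed graph, weight `‖z i‖ ^ 2` by
the left Perron vector of the flocking matrix: the coupling then contributes a sum of squares that
vanishes only if all `z i` agree, and a common value lies in every `V i`, hence is zero by joint
observability. Compactness makes this form coercive (`exists_laplacian_coercive`), so a large `g`
forces any prescribed decay rate (`sum_norm_sq_le_of_constant_graph`).

The weights depend on the graph, so each constant piece costs a factor `κ`, uniform because there
are finitely many graphs. The average dwell time limits this cost to an exponential rate `log κ /
τD`, up to a constant, and `g` is chosen to outrun it (`isBigO_of_switching`). The `K i` enter only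
through the forcing, so the threshold for `g` depends neither on them nor on the chatter bound. -/

namespace DistEst

/-! ### Perron weights and the graph Laplacian -/

/-- An irreducible row-stochastic matrix has a positive left-invariant vector. -/
theorem exists_pos_vecMul_eq {ι : Type*} [Fintype ι] [DecidableEq ι] (S : Matrix ι ι ℝ)
    (hS : ∀ i j, 0 ≤ S i j) (hrow : ∀ i, ∑ j, S i j = 1)
    (hirr : ∀ i j, Relation.ReflTransGen (fun j i => 0 < S i j) i j) :
    ∃ p : ι → ℝ, (∀ i, 0 < p i) ∧ ∀ j, ∑ i, p i * S i j = p j := by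
  rcases isEmpty_or_nonempty ι with _ | _
  · exact ⟨0, fun i => isEmptyElim i, fun i => isEmptyElim i⟩
  have hdet : (1 - S).det = 0 := by
    rw [← Matrix.exists_mulVec_eq_zero_iff]
    refine ⟨fun _ => 1, fun h => ?_, ?_⟩
    · simpa using congrFun h (Classical.arbitrary ι)
    · ext i
      simp [Matrix.mulVec, dotProduct, hrow, Matrix.one_apply]
  obtain ⟨v, hv0, hv⟩ := Matrix.exists_vecMul_eq_zero_iff.2 hdet
  have hinv : ∀ j, ∑ i, v i * S i j = v j := fun j => by
    have := congrFun hv j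
    rw [Matrix.vecMul_sub, Matrix.vecMul_one] at this
    simp only [Pi.sub_apply, Pi.zero_apply, Matrix.vecMul, dotProduct] at this
    linarith
  -- `|v|` is subinvariant, and unit row sums give both sides the same total, so every inequality is
  -- an equality. Irreducibility then spreads positivity from one nonzero entry.
  have hle : ∀ j, |v j| ≤ ∑ i, |v i| * S i j := fun j => by
    rw [← hinv j]
    refine (Finset.abs_sum_le_sum_abs _ _).trans (le_of_eq ?_)
    simp [abs_mul, abs_of_nonneg (hS _ _)]
  have htot : ∑ j, |v j| = ∑ j, ∑ i, |v i| * S i j := by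
    rw [Finset.sum_comm]
    simp [← Finset.mul_sum, hrow]
  have heq : ∀ j, ∑ i, |v i| * S i j = |v j| := fun j =>
    ((Finset.sum_eq_sum_iff_of_le fun j _ => hle j).1 htot j (Finset.mem_univ j)).symm
  refine ⟨fun i => |v i|, fun j => ?_, heq⟩
  obtain ⟨k, hk⟩ := Function.ne_iff.1 hv0
  have hstep : ∀ a b, 0 < |v b| → 0 < S b a → 0 < |v a| := fun a b hb hba => by
    rw [← heq a]
    exact Finset.sum_pos' (fun i _ => mul_nonneg (abs_nonneg _) (hS _ _))
      ⟨b, Finset.mem_univ _, mul_pos hb hba⟩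
  have : ∀ a, Relation.ReflTransGen (fun j i => 0 < S i j) a k → 0 < |v a| := fun a ha => by
    induction ha using Relation.ReflTransGen.head_induction_on with
    | refl => exact abs_pos.2 hk
    | head h _ ih => exact hstep _ _ ih h
  exact this j (hirr j k)

open scoped Classical in
/-- The flocking matrix of a neighbor graph. -/
noncomputable def flockingMatrix {m : ℕ} (G : Digraph (Fin m)) : Matrix (Fin m) (Fin m) ℝ :=
  Matrix.of fun i j => if j ∈ neighbors G i then ((neighbors G i).card : ℝ)⁻¹ else 0

theorem mem_neighbors {m : ℕ} {G : Digraph (Fin m)} {i j : Fin m} :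
    j ∈ neighbors G i ↔ G.Adj j i := by
  simp [neighbors]

theorem flockingMatrix_nonneg {m : ℕ} (G : Digraph (Fin m)) (i j : Fin m) :
    0 ≤ flockingMatrix G i j := by
  simp only [flockingMatrix, Matrix.of_apply]
  split_ifs <;> positivity

theorem flockingMatrix_pos {m : ℕ} {G : Digraph (Fin m)} {i j : Fin m} (h : G.Adj j i) :
    0 < flockingMatrix G i j := by
  have h' := mem_neighbors.2 h
  have : 0 < (neighbors G i).card := Finset.card_pos.2 ⟨j, h'⟩
  simp only [flockingMatrix, Matrix.of_apply, if_pos h']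
  positivity

theorem flockingMatrix_sum {m : ℕ} {G : Digraph (Fin m)} (hG : ∀ i, G.Adj i i) (i : Fin m) :
    ∑ j, flockingMatrix G i j = 1 := by
  have : 0 < (neighbors G i).card := Finset.card_pos.2 ⟨i, mem_neighbors.2 (hG i)⟩
  simp only [flockingMatrix, Matrix.of_apply, Finset.sum_ite_mem, Finset.univ_inter,
    Finset.sum_const, nsmul_eq_mul]
  field_simp

theorem flockingMatrix_sum_smul {m : ℕ} {E : Type*} [AddCommGroup E] [Module ℝ E]
    (G : Digraph (Fin m)) (z : Fin m → E) (i : Fin m) :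
    ∑ j, flockingMatrix G i j • z j =
      ((neighbors G i).card : ℝ)⁻¹ • ∑ j ∈ neighbors G i, z j := by
  simp only [flockingMatrix, Matrix.of_apply, ite_smul, zero_smul, Finset.sum_ite_mem,
    Finset.univ_inter, Finset.smul_sum]

/-- The quadratic form of a weighted graph Laplacian as a sum of squares. -/
theorem sum_inner_laplacian {ι E : Type*} [Fintype ι] [NormedAddCommGroup E]
    [InnerProductSpace ℝ E] (S : Matrix ι ι ℝ) (hrow : ∀ i, ∑ j, S i j = 1)
    (p : ι → ℝ) (hp : ∀ j, ∑ i, p i * S i j = p j) (z : ι → E) :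
    ∑ i, p i * inner ℝ (z i) (z i - ∑ j, S i j • z j) =
      2⁻¹ * ∑ i, ∑ j, p i * S i j * ‖z i - z j‖ ^ 2 := by
  -- `S` need not be symmetric: it is enough that `p i * S i j` has the same marginal `p` in both
  -- indices.
  have h1 : ∑ i, ∑ j, p i * S i j * ‖z i‖ ^ 2 = ∑ i, p i * ‖z i‖ ^ 2 := by
    refine Finset.sum_congr rfl fun i _ => ?_
    rw [← Finset.sum_mul, ← Finset.mul_sum, hrow, mul_one]
  have h2 : ∑ i, ∑ j, p i * S i j * ‖z j‖ ^ 2 = ∑ i, p i * ‖z i‖ ^ 2 := by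
    rw [Finset.sum_comm]
    refine Finset.sum_congr rfl fun j _ => ?_
    rw [← Finset.sum_mul, hp]
  have h3 : ∑ i, p i * inner ℝ (z i) (z i - ∑ j, S i j • z j) =
      ∑ i, p i * ‖z i‖ ^ 2 - ∑ i, ∑ j, p i * S i j * inner ℝ (z i) (z j) := by
    rw [← Finset.sum_sub_distrib]
    refine Finset.sum_congr rfl fun i _ => ?_
    simp only [inner_sub_right, real_inner_self_eq_norm_sq, inner_sum, real_inner_smul_right,
      mul_sub, Finset.mul_sum, mul_assoc]
  have h4 : ∑ i, ∑ j, p i * S i j * ‖z i - z j‖ ^ 2 =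
      ∑ i, ∑ j, p i * S i j * ‖z i‖ ^ 2 + ∑ i, ∑ j, p i * S i j * ‖z j‖ ^ 2 -
        2 * ∑ i, ∑ j, p i * S i j * inner ℝ (z i) (z j) := by
    simp only [Finset.mul_sum, ← Finset.sum_add_distrib, ← Finset.sum_sub_distrib]
    refine Finset.sum_congr rfl fun i _ => Finset.sum_congr rfl fun j _ => ?_
    rw [norm_sub_sq_real]
    ring
  rw [h3, h4, h1, h2]
  ring

/-- A continuous function, homogeneous of degree two and positive on a finite-dimensional
subspace away from zero, dominates a multiple of the squared norm there. -/
theorem exists_pos_mul_norm_sq_le {F : Type*} [NormedAddCommGroup F] [NormedSpace ℝ F]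
    [FiniteDimensional ℝ F] (f : F → ℝ) (hf : Continuous f)
    (hom : ∀ (r : ℝ) z, f (r • z) = r ^ 2 * f z) (U : Submodule ℝ F)
    (hpos : ∀ z ∈ U, z ≠ 0 → 0 < f z) : ∃ c > 0, ∀ z ∈ U, c * ‖z‖ ^ 2 ≤ f z := by
  have hK : IsCompact (Metric.sphere (0 : F) 1 ∩ U) :=
    (isCompact_sphere _ _).inter_right U.closed_of_finiteDimensional
  have key : ∃ c > 0, ∀ z ∈ Metric.sphere (0 : F) 1 ∩ U, c ≤ f z := by
    rcases (Metric.sphere (0 : F) 1 ∩ U).eq_empty_or_nonempty with he | hne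
    · exact ⟨1, one_pos, by simp [he]⟩
    · obtain ⟨z, hz, hmin⟩ := hK.exists_isMinOn hne hf.continuousOn
      refine ⟨f z, hpos z hz.2 fun h => ?_, fun y hy => hmin hy⟩
      simpa [h] using hz.1
  obtain ⟨c, hc, h⟩ := key
  refine ⟨c, hc, fun z hz => ?_⟩
  rcases eq_or_ne z 0 with rfl | hz0
  · have := hom 0 0
    simp at this
    simp [this]
  · have hn : ‖z‖ ≠ 0 := norm_ne_zero_iff.2 hz0
    have := h (‖z‖⁻¹ • z) ⟨by simp [norm_smul, hn], U.smul_mem _ hz⟩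
    rw [hom] at this
    have hn' : 0 < ‖z‖ ^ 2 := by positivity
    calc c * ‖z‖ ^ 2 ≤ (‖z‖⁻¹ ^ 2 * f z) * ‖z‖ ^ 2 := by gcongr
      _ = f z := by field_simp

/-- The weighted Laplacian form of a strongly connected graph is coercive on a product of
subspaces with trivial intersection. -/
theorem exists_laplacian_coercive {m : ℕ} {E : Type*} [NormedAddCommGroup E]
    [InnerProductSpace ℝ E] [FiniteDimensional ℝ E] (V : Fin m → Submodule ℝ E)
    (hV : ∀ x, (∀ i, x ∈ V i) → x = 0) {G : Digraph (Fin m)}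
    (hG : IsSelfArcedStronglyConnected G) :
    ∃ (p : Fin m → ℝ) (κ c : ℝ), 0 < c ∧ (∀ i, 1 ≤ p i) ∧ (∀ i, p i ≤ κ) ∧
      ∀ z : Fin m → E, (∀ i, z i ∈ V i) →
        c * ∑ i, p i * ‖z i‖ ^ 2 ≤
          ∑ i, p i * inner ℝ (z i)
            (z i - ((neighbors G i).card : ℝ)⁻¹ • ∑ j ∈ neighbors G i, z j) := by
  have hirr : ∀ i j, Relation.ReflTransGen (fun j i => 0 < flockingMatrix G i j) i j :=
    fun i j => Relation.ReflTransGen.mono (fun _ _ => flockingMatrix_pos) _ _ (hG.2 i j)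
  obtain ⟨q, hq, hqS⟩ := exists_pos_vecMul_eq (flockingMatrix G) (flockingMatrix_nonneg G)
    (flockingMatrix_sum hG.1) hirr
  rcases isEmpty_or_nonempty (Fin m) with _ | _
  · exact ⟨q, 1, 1, one_pos, fun i => isEmptyElim i, fun i => isEmptyElim i, by simp⟩
  obtain ⟨i₀, hi₀⟩ := Finite.exists_min q
  obtain ⟨i₁, hi₁⟩ := Finite.exists_max q
  -- Scaling the smallest weight to 1 makes the weighted sum of squares dominate the plain one; the
  -- largest weight becomes `κ`.
  set p : Fin m → ℝ := fun i => (q i₀)⁻¹ * q i with hpdef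
  have hq0 : 0 < (q i₀)⁻¹ := inv_pos.2 (hq i₀)
  have hp1 : ∀ i, 1 ≤ p i := fun i => by
    rw [hpdef, ← inv_mul_cancel₀ (hq i₀).ne']
    exact mul_le_mul_of_nonneg_left (hi₀ i) hq0.le
  have hpκ : ∀ i, p i ≤ p i₁ := fun i => mul_le_mul_of_nonneg_left (hi₁ i) hq0.le
  have hp0 : ∀ i, 0 < p i := fun i => one_pos.trans_le (hp1 i)
  have hpS : ∀ j, ∑ i, p i * flockingMatrix G i j = p j := fun j => by
    simp only [hpdef, mul_assoc, ← Finset.mul_sum, hqS]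
  set f : (Fin m → E) → ℝ := fun z =>
    ∑ i, p i * inner ℝ (z i) (z i - ∑ j, flockingMatrix G i j • z j) with hf
  have hfeq : ∀ z, f z = 2⁻¹ * ∑ i, ∑ j, p i * flockingMatrix G i j * ‖z i - z j‖ ^ 2 :=
    sum_inner_laplacian _ (flockingMatrix_sum hG.1) p hpS
  have hterm : ∀ (z : Fin m → E) i j, 0 ≤ p i * flockingMatrix G i j * ‖z i - z j‖ ^ 2 :=
    fun z i j => mul_nonneg (mul_nonneg (hp0 i).le (flockingMatrix_nonneg G i j)) (sq_nonneg _)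
  have hpos : ∀ z ∈ Submodule.pi Set.univ V, z ≠ 0 → 0 < f z := fun z hz hz0 => by
    have hf0 : 0 ≤ f z := by
      rw [hfeq]
      exact mul_nonneg (by norm_num) (Finset.sum_nonneg fun i _ =>
        Finset.sum_nonneg fun j _ => hterm z i j)
    refine lt_of_le_of_ne hf0 fun h => hz0 ?_
    rw [hfeq, eq_comm, mul_eq_zero, or_iff_right (by norm_num), Finset.sum_eq_zero_iff_of_nonneg
      fun i _ => Finset.sum_nonneg fun j _ => hterm z i j] at h
    have hadj : ∀ i j, G.Adj j i → z j = z i := fun i j hij => by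
      have := (Finset.sum_eq_zero_iff_of_nonneg fun j _ => hterm z i j).1
        (h i (Finset.mem_univ i)) j (Finset.mem_univ j)
      have h1 := (mul_pos (hp0 i) (flockingMatrix_pos hij)).ne'
      rw [mul_eq_zero, or_iff_right h1, sq_eq_zero_iff, norm_eq_zero, sub_eq_zero] at this
      exact this.symm
    have hall : ∀ i j, z i = z j := fun i j => by
      have := hG.2 i j
      induction this with
      | refl => rfl
      | tail _ hbc ih => exact ih.trans (hadj _ _ hbc)
    ext i : 1
    exact hV _ fun j => hall i j ▸ hz j (Set.mem_univ j)
  obtain ⟨c, hc, hcf⟩ := exists_pos_mul_norm_sq_le f (by fun_prop) (fun r z => by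
    rw [hfeq, hfeq]
    simp only [Pi.smul_apply, ← smul_sub, norm_smul, mul_pow, Real.norm_eq_abs, sq_abs,
      Finset.mul_sum]
    refine Finset.sum_congr rfl fun i _ => Finset.sum_congr rfl fun j _ => ?_
    ring) (Submodule.pi Set.univ V) hpos
  have hsum : 0 < ∑ i, p i := Finset.sum_pos (fun i _ => hp0 i) Finset.univ_nonempty
  -- The norm on `Fin m → E` is the sup norm, so the weighted sum of squares is at most `∑ i, p i`
  -- times its square.
  refine ⟨p, p i₁, c * (∑ i, p i)⁻¹, by positivity, hp1, hpκ, fun z hz => ?_⟩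
  have hz' := hcf z fun i _ => hz i
  simp only [hf, flockingMatrix_sum_smul] at hz'
  refine le_trans ?_ hz'
  rw [mul_assoc]
  refine mul_le_mul_of_nonneg_left ?_ hc.le
  rw [inv_mul_le_iff₀ hsum, Finset.sum_mul]
  gcongr with i
  · exact (hp0 i).le
  · exact norm_le_pi_norm z i

/-- The coercivity constants can be chosen uniformly in the graph. -/
theorem exists_uniform_laplacian_coercive {m : ℕ} {E : Type*} [NormedAddCommGroup E]
    [InnerProductSpace ℝ E] [FiniteDimensional ℝ E] (V : Fin m → Submodule ℝ E)
    (hV : ∀ x, (∀ i, x ∈ V i) → x = 0) :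
    ∃ κ c : ℝ, 1 ≤ κ ∧ 0 < c ∧ ∀ G : Digraph (Fin m), IsSelfArcedStronglyConnected G →
      ∃ p : Fin m → ℝ, (∀ i, 1 ≤ p i) ∧ (∀ i, p i ≤ κ) ∧
        ∀ z : Fin m → E, (∀ i, z i ∈ V i) →
          c * ∑ i, p i * ‖z i‖ ^ 2 ≤
            ∑ i, p i * inner ℝ (z i)
              (z i - ((neighbors G i).card : ℝ)⁻¹ • ∑ j ∈ neighbors G i, z j) := by
  have : Finite (Digraph (Fin m)) :=
    Finite.of_injective (fun G : Digraph (Fin m) => G.Adj) fun _ _ => Digraph.ext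
  choose p κ c hc hp1 hpκ h using fun G : {G : Digraph (Fin m) // IsSelfArcedStronglyConnected G} =>
    exists_laplacian_coercive V hV G.2
  obtain ⟨M, hM⟩ := (Set.finite_range κ).bddAbove
  obtain ⟨M', hM'⟩ := (Set.finite_range fun G => (c G)⁻¹).bddAbove
  refine ⟨max 1 M, (max 1 M')⁻¹, le_max_left _ _, by positivity, fun G hG =>
    ⟨p ⟨G, hG⟩, hp1 _, fun i => (hpκ _ i).trans ((hM ⟨_, rfl⟩).trans (le_max_right _ _)),
      fun z hz => le_trans ?_ (h ⟨G, hG⟩ z hz)⟩⟩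
  refine mul_le_mul_of_nonneg_right (inv_le_of_inv_le₀ (hc _) ?_) (Finset.sum_nonneg fun i _ =>
    mul_nonneg (zero_le_one.trans (hp1 _ i)) (sq_nonneg _))
  exact (hM' ⟨⟨G, hG⟩, rfl⟩).trans (le_max_right _ _)

/-! ### Switching signals and average dwell time -/

/-- A signal without discontinuities in an open interval is constant there. -/
theorem eq_of_discontinuities_eq_empty {α : Type*} {N : ℝ → α} {a b : ℝ}
    (h : discontinuities N a b = ∅) {s t : ℝ} (hs : s ∈ Set.Ioo a b) (ht : t ∈ Set.Ioo a b) :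
    N s = N t := by
  -- In the discrete topology, having no discontinuity is continuity, and a continuous map from an
  -- interval is constant.
  let _ : TopologicalSpace α := ⊥
  have : DiscreteTopology α := ⟨rfl⟩
  refine isPreconnected_Ioo.constant (f := N) (fun r hr => ?_) hs ht
  have : ¬ IsDiscontinuity N r := fun hd => by
    have : r ∈ discontinuities N a b := ⟨hr, hd⟩
    simp [h] at this
  rw [IsDiscontinuity, not_not] at this
  refine ContinuousAt.continuousWithinAt ?_
  rw [ContinuousAt, nhds_discrete α, tendsto_pure]
  exact this

theorem ncard_discontinuities_split {α : Type*} {N : ℝ → α} {a b c : ℝ}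
    (hb : b ∈ discontinuities N a c) (hfin : (discontinuities N a c).Finite) :
    (discontinuities N a c).ncard =
      (discontinuities N a b).ncard + (discontinuities N b c).ncard + 1 := by
  have hab : discontinuities N a b ⊆ discontinuities N a c :=
    fun t ht => ⟨⟨ht.1.1, ht.1.2.trans hb.1.2⟩, ht.2⟩
  have hbc : discontinuities N b c ⊆ discontinuities N a c :=
    fun t ht => ⟨⟨hb.1.1.trans ht.1.1, ht.1.2⟩, ht.2⟩
  have hdisj : Disjoint (discontinuities N a b) (discontinuities N b c) :=
    Set.disjoint_left.2 fun t h1 h2 => lt_asymm h1.1.2 h2.1.1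
  have hnot : b ∉ discontinuities N a b ∪ discontinuities N b c := by
    rintro (h | h)
    · exact lt_irrefl _ h.1.2
    · exact lt_irrefl _ h.1.1
  have heq : discontinuities N a c =
      insert b (discontinuities N a b ∪ discontinuities N b c) := by
    refine Set.Subset.antisymm (fun t ht => ?_)
      (Set.insert_subset hb (Set.union_subset hab hbc))
    rcases lt_trichotomy t b with h | h | h
    · exact Or.inr (Or.inl ⟨⟨ht.1.1, h⟩, ht.2⟩)
    · exact Or.inl h
    · exact Or.inr (Or.inr ⟨⟨h, ht.1.2⟩, ht.2⟩)
  rw [heq, Set.ncard_insert_of_notMem hnot ((hfin.subset hab).union (hfin.subset hbc)),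
    Set.ncard_union_eq hdisj (hfin.subset hab) (hfin.subset hbc)]

/-- Growth over an interval with several switches, when every switch costs a factor `κ`. -/
theorem le_of_switching {α : Type*} {N : ℝ → α} {W : ℝ → ℝ} {κ γ d s₀ : ℝ}
    (hκ : 1 ≤ κ) (hd : 0 ≤ d) (hγ : 0 ≤ γ)
    (hstep : ∀ s t, s₀ ≤ s → s ≤ t → discontinuities N s t = ∅ →
      W t ≤ κ * (Real.exp (-γ * (t - s)) * W s + d)) (k : ℕ) :
    ∀ s t, s₀ ≤ s → s ≤ t → (discontinuities N s t).Finite → (discontinuities N s t).ncard = k →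
      W t ≤ κ ^ (k + 1) * (Real.exp (-γ * (t - s)) * W s + (k + 1) * d) := by
  -- Cut at any one switch. `k` interior switches leave `k + 1` constant pieces, each paying one `κ`
  -- and one `d`, and `k + 1 = (k₁ + 1) + (k₂ + 1)`.
  induction k using Nat.strong_induction_on with
  | _ k ih =>
    intro s t hs hst hfin hk
    rcases (discontinuities N s t).eq_empty_or_nonempty with he | ⟨r, hr⟩
    · have hk0 : k = 0 := by rw [← hk, he, Set.ncard_empty]
      subst hk0
      simpa using hstep s t hs hst he
    · have hsplit := ncard_discontinuities_split hr hfin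
      have hfin₁ : (discontinuities N s r).Finite :=
        hfin.subset fun t ht => ⟨⟨ht.1.1, ht.1.2.trans hr.1.2⟩, ht.2⟩
      have hfin₂ : (discontinuities N r t).Finite :=
        hfin.subset fun t ht => ⟨⟨hr.1.1.trans ht.1.1, ht.1.2⟩, ht.2⟩
      set k₁ := (discontinuities N s r).ncard
      set k₂ := (discontinuities N r t).ncard
      have h₁ := ih k₁ (by omega) s r hs hr.1.1.le hfin₁ rfl
      have h₂ := ih k₂ (by omega) r t (hs.trans hr.1.1.le) hr.1.2.le hfin₂ rfl
      have hkk : k = k₁ + k₂ + 1 := by omega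
      have hE : Real.exp (-γ * (t - r)) ≤ 1 :=
        Real.exp_le_one_iff.2 (by nlinarith [hr.1.2])
      have hEE : Real.exp (-γ * (t - s)) =
          Real.exp (-γ * (t - r)) * Real.exp (-γ * (r - s)) := by
        rw [← Real.exp_add]; ring_nf
      have hκ₁ : 1 ≤ κ ^ (k₁ + 1) := one_le_pow₀ hκ
      have hκ0 : 0 ≤ κ := zero_le_one.trans hκ
      have hk₂d : 0 ≤ ((k₂ : ℝ) + 1) * d := by positivity
      have hk₁d : 0 ≤ ((k₁ : ℝ) + 1) * d := by positivity
      calc W t ≤ κ ^ (k₂ + 1) * (Real.exp (-γ * (t - r)) * W r + (k₂ + 1) * d) := h₂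
        _ ≤ κ ^ (k₂ + 1) * (Real.exp (-γ * (t - r)) *
              (κ ^ (k₁ + 1) * (Real.exp (-γ * (r - s)) * W s + (k₁ + 1) * d)) +
              κ ^ (k₁ + 1) * ((k₂ + 1) * d)) := by
            gcongr κ ^ (k₂ + 1) * (Real.exp (-γ * (t - r)) * ?_ + ?_)
            exact le_mul_of_one_le_left hk₂d hκ₁
        _ = κ ^ (k + 1) * (Real.exp (-γ * (t - s)) * W s +
              (Real.exp (-γ * (t - r)) * ((k₁ + 1) * d) + (k₂ + 1) * d)) := by
            rw [hEE, hkk]; ring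
        _ ≤ κ ^ (k + 1) * (Real.exp (-γ * (t - s)) * W s + (1 * ((k₁ + 1) * d) + (k₂ + 1) * d)) := by
            gcongr
        _ = κ ^ (k + 1) * (Real.exp (-γ * (t - s)) * W s + (k + 1) * d) := by
            rw [hkk]; push_cast; ring

/-- Exponential decay under switching with average dwell time `τD`, when every switch costs a
factor `exp ℓ` and the decay rate between switches exceeds `ℓ / τD + μ` by one. -/
theorem isBigO_of_switching {m : ℕ} {N : ℝ → Digraph (Fin m)} {W : ℝ → ℝ} {ℓ B μ τD δ₀ : ℝ}
    (hℓ : 0 ≤ ℓ) (hB : 0 ≤ B) (hμ : 0 ≤ μ) (hτD : 0 < τD) (hW : ∀ t, 0 ≤ W t)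
    (hN : IsAvgDwellNeighborGraph τD δ₀ N)
    (hstep : ∀ s t, 0 ≤ s → s ≤ t → discontinuities N s t = ∅ →
      W t ≤ Real.exp ℓ * (Real.exp (-(ℓ / τD + μ + 1) * (t - s)) * W s +
        B * Real.exp (-μ * s))) :
    W =O[atTop] fun t => Real.exp (-μ * t) := by
  set γ := ℓ / τD + μ + 1 with hγdef
  have hγ : 0 ≤ γ := by positivity
  -- The chatter bound may be negative.
  set D := max δ₀ 0
  have hD : 0 ≤ D := le_max_right _ _
  -- In `H * exp (-γ * L)` the terms `ℓ * L / τD` cancel, leaving the exponent `ℓ * (D + 1) - L - μ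
  -- * L`; this `L` makes it `-1 - μ * L`.
  set L := ℓ * (D + 1) + 1 with hLdef
  have hL : 0 < L := by positivity
  set Kmax := D + L / τD with hKdef
  set H := Real.exp (ℓ * (Kmax + 1)) with hHdef
  have hK0 : 0 ≤ Kmax := by positivity
  -- one window
  have hwin : ∀ s t, 0 ≤ s → s ≤ t → t ≤ s + L →
      W t ≤ H * (Real.exp (-γ * (t - s)) * W s + (Kmax + 1) * (B * Real.exp (-μ * s))) := by
    intro s t hs hst htL
    obtain ⟨hfin, hcard⟩ := hN.2 s t hs hst
    have h := le_of_switching (N := N) (W := W) (s₀ := s) (d := B * Real.exp (-μ * s))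
      (Real.one_le_exp hℓ) (by positivity) hγ
      (fun a b hsa hab he => (hstep a b (hs.trans hsa) hab he).trans (by
        have := hW a
        gcongr Real.exp ℓ * (_ + B * Real.exp ?_)
        nlinarith)) _ s t le_rfl hst hfin rfl
    have hk : ((discontinuities N s t).ncard : ℝ) ≤ Kmax := by
      refine hcard.trans (add_le_add (le_max_left _ _) ?_)
      gcongr
      linarith
    refine h.trans ?_
    have := hW s
    have hH : Real.exp ℓ ^ ((discontinuities N s t).ncard + 1) ≤ H := by
      rw [← Real.exp_nat_mul, hHdef, mul_comm]
      gcongr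
      push_cast
      linarith
    gcongr
  -- contraction over a full window
  have hcontr : H * Real.exp (-γ * L) ≤ 2⁻¹ * Real.exp (-μ * L) := by
    have h1 : H * Real.exp (-γ * L) = Real.exp (-1) * Real.exp (-μ * L) := by
      rw [hHdef, ← Real.exp_add, ← Real.exp_add]
      congr 1
      rw [hKdef, hγdef, hLdef]
      field_simp
      ring
    rw [h1]
    gcongr
    rw [Real.exp_neg]
    refine inv_anti₀ two_pos ?_
    have := Real.add_one_le_exp (1 : ℝ)
    linarith
  set F := H * ((Kmax + 1) * B) with hF
  have hF0 : 0 ≤ F := by positivity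
  -- Chosen so that `M / 2 + F * exp (μ * L) ≤ M`, which closes the induction over windows.
  set M := max (W 0) (2 * (F * Real.exp (μ * L))) with hM
  have hM0 : 0 ≤ M := (hW 0).trans (le_max_left _ _)
  have hseq : ∀ k : ℕ, W (k * L) ≤ M * Real.exp (-μ * (k * L)) := by
    intro k
    induction k with
    | zero => simp [hM]
    | succ k ih =>
      have h := hwin (k * L) ((k + 1 : ℕ) * L) (by positivity)
        (by push_cast; linarith) (by push_cast; linarith)
      have hsub : ((k + 1 : ℕ) * L - k * L) = L := by push_cast; ring
      rw [hsub] at h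
      have hE : Real.exp (-μ * ((k + 1 : ℕ) * L)) =
          Real.exp (-μ * L) * Real.exp (-μ * (k * L)) := by
        rw [← Real.exp_add]; push_cast; ring_nf
      have hinv : Real.exp (μ * L) * Real.exp (-μ * L) = 1 := by
        rw [← Real.exp_add]; simp
      calc W ((k + 1 : ℕ) * L) ≤ (H * Real.exp (-γ * L)) * W (k * L) +
            F * Real.exp (-μ * (k * L)) := by rw [hF]; linarith
        _ ≤ (2⁻¹ * Real.exp (-μ * L)) * (M * Real.exp (-μ * (k * L))) +
            (F * (Real.exp (μ * L) * Real.exp (-μ * L))) * Real.exp (-μ * (k * L)) := by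
          rw [hinv, mul_one]
          have := hW (k * L)
          gcongr
        _ = (2⁻¹ * M + F * Real.exp (μ * L)) * Real.exp (-μ * ((k + 1 : ℕ) * L)) := by
          rw [hE]; ring
        _ ≤ M * Real.exp (-μ * ((k + 1 : ℕ) * L)) := by
          gcongr
          have : 2 * (F * Real.exp (μ * L)) ≤ M := le_max_right _ _
          linarith
  refine IsBigO.of_bound (H * (M + (Kmax + 1) * B) * Real.exp (μ * L)) ?_
  filter_upwards [eventually_ge_atTop 0] with t ht
  rw [Real.norm_of_nonneg (hW t), Real.norm_of_nonneg (Real.exp_pos _).le]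
  set k := ⌊t / L⌋₊
  have hk1 : k * L ≤ t := (le_div_iff₀ hL).1 (Nat.floor_le (by positivity))
  have hk2 : t ≤ k * L + L := by
    have := (div_lt_iff₀ hL).1 (Nat.lt_floor_add_one (t / L))
    linarith
  have h := hwin (k * L) t (by positivity) hk1 hk2
  have hE1 : Real.exp (-γ * (t - k * L)) ≤ 1 := Real.exp_le_one_iff.2 (by nlinarith)
  have hE2 : Real.exp (-μ * (k * L)) ≤ Real.exp (μ * L) * Real.exp (-μ * t) := by
    rw [← Real.exp_add]
    gcongr
    nlinarith
  calc W t ≤ _ := h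
    _ ≤ H * (1 * (M * Real.exp (-μ * (k * L))) + (Kmax + 1) * (B * Real.exp (-μ * (k * L)))) := by
      have := hW (k * L)
      gcongr
      exact hseq k
    _ = H * (M + (Kmax + 1) * B) * Real.exp (-μ * (k * L)) := by ring
    _ ≤ H * (M + (Kmax + 1) * B) * (Real.exp (μ * L) * Real.exp (-μ * t)) := by gcongr
    _ = _ := by ring

/-! ### Decay between switches -/

/-- A scalar Grönwall inequality on an interval, with the differential inequality in the
interior. -/
theorem le_of_hasDerivAt_le_neg_mul_sub {f f' : ℝ → ℝ} {γ d s t : ℝ} (hst : s ≤ t) (hd : 0 ≤ d)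
    (hf : ContinuousOn f (Set.Icc s t)) (hf' : ∀ r ∈ Set.Ioo s t, HasDerivAt f (f' r) r)
    (hle : ∀ r ∈ Set.Ioo s t, f' r ≤ -γ * (f r - d)) :
    f t ≤ Real.exp (-γ * (t - s)) * f s + d := by
  have hder : ∀ r ∈ Set.Ioo s t, HasDerivAt (fun r => Real.exp (γ * r) * (f r - d))
      (Real.exp (γ * r) * γ * (f r - d) + Real.exp (γ * r) * f' r) r := fun r hr => by
    have h1 : HasDerivAt (fun r => Real.exp (γ * r)) (Real.exp (γ * r) * γ) r := by
      simpa using ((hasDerivAt_id r).const_mul γ).exp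
    exact h1.mul ((hf' r hr).sub_const d)
  have hanti : AntitoneOn (fun r => Real.exp (γ * r) * (f r - d)) (Set.Icc s t) := by
    refine antitoneOn_of_deriv_nonpos (convex_Icc s t) ?_ ?_ ?_
    · exact (by fun_prop : Continuous fun r => Real.exp (γ * r)).continuousOn.mul
        (hf.sub continuousOn_const)
    · rw [interior_Icc]
      exact fun r hr => (hder r hr).differentiableAt.differentiableWithinAt
    · rw [interior_Icc]
      intro r hr
      rw [(hder r hr).deriv]
      have := mul_le_mul_of_nonneg_left (hle r hr) (Real.exp_pos (γ * r)).le
      linarith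
  have h := hanti (Set.left_mem_Icc.2 hst) (Set.right_mem_Icc.2 hst) hst
  have hE : Real.exp (-γ * (t - s)) * Real.exp (γ * t) = Real.exp (γ * s) := by
    rw [← Real.exp_add]; ring_nf
  have h2 : f t - d ≤ Real.exp (-γ * (t - s)) * (f s - d) := by
    have hE2 : Real.exp (-γ * (t - s)) = Real.exp (γ * s) * (Real.exp (γ * t))⁻¹ := by
      rw [← hE]; field_simp
    rw [hE2, mul_right_comm, ← div_eq_mul_inv, le_div_iff₀ (Real.exp_pos _)]
    simp only at h
    linarith
  have h3 : 0 ≤ Real.exp (-γ * (t - s)) * d := by positivity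
  linarith

theorem inner_starProjection_of_mem {E : Type*} [NormedAddCommGroup E] [InnerProductSpace ℝ E]
    {V : Submodule ℝ E} [V.HasOrthogonalProjection] {x : E} (hx : x ∈ V) (y : E) :
    inner ℝ x (V.starProjection y) = inner ℝ x y := by
  rw [← Submodule.inner_starProjection_left_eq_right, Submodule.starProjection_eq_self_iff.2 hx]

/-- Decay of the components in the unobservable spaces while the neighbor graph is constant. -/
theorem sum_norm_sq_le_of_constant_graph {m : ℕ} {E : Type*} [NormedAddCommGroup E]
    [InnerProductSpace ℝ E] (V : Fin m → Submodule ℝ E) [∀ i, (V i).HasOrthogonalProjection]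
    (A : E →L[ℝ] E) {G : Digraph (Fin m)} {p : Fin m → ℝ} {κ c g γ d s t : ℝ}
    (hg : 0 ≤ g) (hγ : 1 ≤ γ) (hgc : γ + 2 * ‖A‖ + 1 ≤ 2 * g * c) (hd : 0 ≤ d)
    (hp : ∀ i, 1 ≤ p i) (hpκ : ∀ i, p i ≤ κ) (hκ : 1 ≤ κ)
    (hcoer : ∀ z : Fin m → E, (∀ i, z i ∈ V i) → c * ∑ i, p i * ‖z i‖ ^ 2 ≤
      ∑ i, p i * inner ℝ (z i) (z i - ((neighbors G i).card : ℝ)⁻¹ • ∑ j ∈ neighbors G i, z j))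
    {z b : Fin m → ℝ → E} (hzV : ∀ i r, z i r ∈ V i) (hst : s ≤ t)
    (hz : ∀ i, ContinuousOn (z i) (Set.Icc s t))
    (hz' : ∀ i, ∀ r ∈ Set.Ioo s t, HasDerivAt (z i)
      ((V i).starProjection (A (z i r)) - g • (V i).starProjection
        (z i r - ((neighbors G i).card : ℝ)⁻¹ • ∑ j ∈ neighbors G i, z j r) + b i r) r)
    (hb : ∀ r ∈ Set.Ioo s t, ∑ i, ‖b i r‖ ^ 2 ≤ d) :
    ∑ i, ‖z i t‖ ^ 2 ≤ κ * (Real.exp (-γ * (t - s)) * ∑ i, ‖z i s‖ ^ 2 + d) := by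
  have hp0 : ∀ i, 0 ≤ p i := fun i => zero_le_one.trans (hp i)
  -- As `1 ≤ p i ≤ κ`, passing to the weighted sum and back costs one factor `κ`.
  set f : ℝ → ℝ := fun r => ∑ i, p i * ‖z i r‖ ^ 2 with hf
  have hf0 : ∀ r, 0 ≤ f r := fun r =>
    Finset.sum_nonneg fun i _ => mul_nonneg (hp0 i) (sq_nonneg _)
  have key := le_of_hasDerivAt_le_neg_mul_sub (f := f) (γ := γ) (d := κ * d)
    (f' := fun r => ∑ i, p i * (2 * inner ℝ (z i r) ((V i).starProjection (A (z i r)) -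
      g • (V i).starProjection
        (z i r - ((neighbors G i).card : ℝ)⁻¹ • ∑ j ∈ neighbors G i, z j r) + b i r))) hst
    (by positivity)
    (continuousOn_finsetSum _ fun i _ => continuousOn_const.mul ((hz i).norm.pow 2))
    (fun r hr => HasDerivAt.fun_sum fun i _ => ((hz' i r hr).norm_sq).const_mul (p i))
    (fun r hr => ?_)
  · calc ∑ i, ‖z i t‖ ^ 2 ≤ f t :=
          Finset.sum_le_sum fun i _ => le_mul_of_one_le_left (sq_nonneg _) (hp i)
      _ ≤ Real.exp (-γ * (t - s)) * f s + κ * d := key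
      _ ≤ Real.exp (-γ * (t - s)) * (κ * ∑ i, ‖z i s‖ ^ 2) + κ * d := by
          gcongr
          rw [Finset.mul_sum]
          exact Finset.sum_le_sum fun i _ => mul_le_mul_of_nonneg_right (hpκ i) (sq_nonneg _)
      _ = _ := by ring
  -- The projections drop out because `z i r` lies in `V i`. The summand 1 in `hgc` pays for Young's
  -- inequality on the forcing term.
  · have h1 : ∀ i, p i * (2 * inner ℝ (z i r) ((V i).starProjection (A (z i r)) -
        g • (V i).starProjection
          (z i r - ((neighbors G i).card : ℝ)⁻¹ • ∑ j ∈ neighbors G i, z j r) + b i r)) ≤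
        (2 * ‖A‖ + 1) * (p i * ‖z i r‖ ^ 2) + κ * ‖b i r‖ ^ 2 - 2 * g * (p i * inner ℝ (z i r)
          (z i r - ((neighbors G i).card : ℝ)⁻¹ • ∑ j ∈ neighbors G i, z j r)) := by
      intro i
      rw [inner_add_right, inner_sub_right, real_inner_smul_right,
        inner_starProjection_of_mem (hzV i r), inner_starProjection_of_mem (hzV i r)]
      have ha : inner ℝ (z i r) (A (z i r)) ≤ ‖A‖ * ‖z i r‖ ^ 2 := by
        refine (real_inner_le_norm _ _).trans ?_
        have := mul_le_mul_of_nonneg_left (A.le_opNorm (z i r)) (norm_nonneg (z i r))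
        linarith
      have hbb : 2 * inner ℝ (z i r) (b i r) ≤ ‖z i r‖ ^ 2 + ‖b i r‖ ^ 2 := by
        have := real_inner_le_norm (z i r) (b i r)
        nlinarith [sq_nonneg (‖z i r‖ - ‖b i r‖)]
      have h2 := mul_le_mul_of_nonneg_left ha (hp0 i)
      have h3 := mul_le_mul_of_nonneg_left hbb (hp0 i)
      have h4 := mul_le_mul_of_nonneg_right (hpκ i) (sq_nonneg ‖b i r‖)
      linarith
    have h5 := hcoer (fun i => z i r) fun i => hzV i r
    have h6 : 2 * g * (c * f r) ≤ 2 * g * ∑ i, p i * inner ℝ (z i r)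
        (z i r - ((neighbors G i).card : ℝ)⁻¹ • ∑ j ∈ neighbors G i, z j r) :=
      mul_le_mul_of_nonneg_left h5 (by positivity)
    have h7 := mul_le_mul_of_nonneg_right hgc (hf0 r)
    have h8 := mul_le_mul_of_nonneg_left (hb r hr) (zero_le_one.trans hκ)
    have h9 : κ * d ≤ γ * (κ * d) := le_mul_of_one_le_left (by positivity) hγ
    calc _ ≤ ∑ i, ((2 * ‖A‖ + 1) * (p i * ‖z i r‖ ^ 2) + κ * ‖b i r‖ ^ 2 - 2 * g * (p i *
          inner ℝ (z i r)
            (z i r - ((neighbors G i).card : ℝ)⁻¹ • ∑ j ∈ neighbors G i, z j r))) :=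
          Finset.sum_le_sum fun i _ => h1 i
      _ = (2 * ‖A‖ + 1) * f r + κ * ∑ i, ‖b i r‖ ^ 2 - 2 * g * ∑ i, p i * inner ℝ (z i r)
            (z i r - ((neighbors G i).card : ℝ)⁻¹ • ∑ j ∈ neighbors G i, z j r) := by
          rw [Finset.sum_sub_distrib, Finset.sum_add_distrib, ← Finset.mul_sum, ← Finset.mul_sum,
            ← Finset.mul_sum]
      _ ≤ -γ * (f r - κ * d) := by linarith

/-! ### Linear equations and exponentials -/

/-- Solutions of `q' = M q`, where the equation may fail at countably many times. -/
theorem eq_exp_smul_apply {X : Type*} [NormedAddCommGroup X] [NormedSpace ℝ X] [CompleteSpace X]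
    (M : X →L[ℝ] X) {q : ℝ → X} {D : Set ℝ} (hD : D.Countable)
    (hq : ContinuousOn q (Set.Ici 0)) (hq' : ∀ t, 0 < t → t ∉ D → HasDerivAt q (M (q t)) t)
    {t : ℝ} (ht : 0 ≤ t) : q t = NormedSpace.exp (t • M) (q 0) := by
  have hexp : ∀ r : ℝ, HasDerivAt (fun u : ℝ => NormedSpace.exp (u • -M))
      (NormedSpace.exp (r • -M) * -M) r := fun r => hasDerivAt_exp_smul_const (-M) r
  have hcont : Continuous fun u : ℝ => NormedSpace.exp (u • -M) :=
    continuous_iff_continuousAt.2 fun r => (hexp r).continuousAt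
  -- `exp (-r M) q(r)` is continuous with zero derivative off `D`, hence constant.
  have hint := MeasureTheory.integral_eq_of_hasDerivAt_off_countable
    (fun r => NormedSpace.exp (r • -M) (q r)) (fun _ => 0) (a := 0) (b := t) hD
    (by
      rw [Set.uIcc_of_le ht]
      exact hcont.continuousOn.clm_apply (hq.mono fun r hr => hr.1))
    (fun r hr => by
      rw [min_eq_left ht, max_eq_right ht] at hr
      have := (hexp r).clm_apply (hq' r hr.1.1 hr.2)
      simpa using this) (by simp)
  simp only [intervalIntegral.integral_zero, zero_smul, NormedSpace.exp_zero,
    one_apply_eq_self] at hint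
  let _ : NormedAlgebra ℚ (X →L[ℝ] X) := NormedAlgebra.restrictScalars ℚ ℝ _
  have hinv : NormedSpace.exp (t • M) * NormedSpace.exp (t • -M) = 1 := by
    rw [← NormedSpace.exp_add_of_commute
      (((Commute.refl M).neg_right).smul_left t |>.smul_right t)]
    simp
  have := congrArg (fun T : X →L[ℝ] X => T (q t)) hinv
  simp only [mul_apply_eq_comp, one_apply_eq_self] at this
  rw [← this, sub_eq_zero.1 hint.symm]

/-- A signal that is continuous on `[0, ∞)` and decays exponentially is bounded by an exponential
on all of `[0, ∞)`. -/
theorem exists_bound_of_isBigO_exp {X : Type*} [NormedAddCommGroup X] {q : ℝ → X} {lam : ℝ}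
    (hq : ContinuousOn q (Set.Ici 0)) (h : q =O[atTop] fun t => Real.exp (-lam * t)) :
    ∃ c, 0 ≤ c ∧ ∀ t, 0 ≤ t → ‖q t‖ ≤ c * Real.exp (-lam * t) := by
  obtain ⟨c, hc⟩ := h.bound
  obtain ⟨T, hT⟩ := eventually_atTop.1 hc
  have hcont : ContinuousOn (fun t => ‖q t‖ * Real.exp (lam * t)) (Set.Icc 0 T) :=
    (hq.mono fun t ht => ht.1).norm.mul (by fun_prop)
  obtain ⟨c', hc'⟩ := isCompact_Icc.bddAbove_image hcont
  refine ⟨max (max c c') 0, le_max_right _ _, fun t ht => ?_⟩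
  rcases le_total T t with hTt | hTt
  · have := hT t hTt
    rw [Real.norm_of_nonneg (Real.exp_pos _).le] at this
    refine this.trans ?_
    gcongr
    exact (le_max_left _ _).trans (le_max_left _ _)
  · have := hc' ⟨t, ⟨ht, hTt⟩, rfl⟩
    rw [neg_mul, Real.exp_neg, ← div_eq_mul_inv, le_div_iff₀ (Real.exp_pos _)]
    exact this.trans ((le_max_right _ _).trans (le_max_left _ _))

/-- The exponential depends only on the topology, so an auxiliary operator norm on matrices may be
used to see that a continuous algebra isomorphism commutes with it. -/
theorem toEuclideanCLM_exp {r : ℕ} (M : Matrix (Fin r) (Fin r) ℝ) :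
    Matrix.toEuclideanCLM (𝕜 := ℝ) (NormedSpace.exp M) =
      NormedSpace.exp (Matrix.toEuclideanCLM (𝕜 := ℝ) M) := by
  let _ : NormedRing (Matrix (Fin r) (Fin r) ℝ) := Matrix.linftyOpNormedRing
  let _ : NormedAlgebra ℝ (Matrix (Fin r) (Fin r) ℝ) := Matrix.linftyOpNormedAlgebra
  let _ : NormedAlgebra ℚ (Matrix (Fin r) (Fin r) ℝ) := NormedAlgebra.restrictScalars ℚ ℝ _
  exact NormedSpace.map_exp (Matrix.toEuclideanCLM (𝕜 := ℝ))
    (LinearMap.continuous_of_finiteDimensional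
      (Matrix.toEuclideanCLM (𝕜 := ℝ) (n := Fin r)).toAlgEquiv.toLinearMap) M

/-- Entrywise decay of the matrix exponential in terms of its action on vectors. -/
theorem expDecaysAtRate_iff {r : ℕ} (M : Matrix (Fin r) (Fin r) ℝ) (lam : ℝ) :
    ExpDecaysAtRate M lam ↔ ∀ v : EuclideanSpace ℝ (Fin r),
      (fun t : ℝ => NormedSpace.exp (t • Matrix.toEuclideanCLM (𝕜 := ℝ) M) v) =O[atTop]
        fun t => Real.exp (-lam * t) := by
  have happ : ∀ (t : ℝ) (v : EuclideanSpace ℝ (Fin r)) (a : Fin r),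
      NormedSpace.exp (t • Matrix.toEuclideanCLM (𝕜 := ℝ) M) v a =
        ∑ b, NormedSpace.exp (t • M) a b * v b := fun t v a => by
    rw [← map_smul, ← toEuclideanCLM_exp]
    rfl
  constructor
  · intro h v
    have h1 : (fun t : ℝ => fun a => NormedSpace.exp (t • Matrix.toEuclideanCLM (𝕜 := ℝ) M) v a)
        =O[atTop] fun t => Real.exp (-lam * t) := by
      refine isBigO_pi.2 fun a => ?_
      simp only [happ]
      exact IsBigO.fun_sum fun b _ => by
        simpa [mul_comm] using (h a b).const_mul_left (v b)
    exact ((EuclideanSpace.equiv (Fin r) ℝ).symm.toContinuousLinearMap.isBigO_comp _ _).trans h1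
  · intro h a b
    have h1 := ((EuclideanSpace.proj (𝕜 := ℝ) a).isBigO_comp _ _).trans
      (h (EuclideanSpace.single b 1))
    refine h1.congr_left fun t => ?_
    simp [happ]

/-! ### Stabilization by output injection -/

/-- An observable pair of operators can be stabilized by output injection at any given rate. The
gain comes from the observability Gramian of `-(A + lam)` over the unit interval. -/
theorem exists_outputInjection {E F : Type*} [NormedAddCommGroup E] [InnerProductSpace ℝ E]
    [FiniteDimensional ℝ E] [NormedAddCommGroup F] [InnerProductSpace ℝ F]
    [FiniteDimensional ℝ F] (A : E →L[ℝ] E) (C : E →L[ℝ] F) (lam : ℝ)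
    (hobs : ∀ x, (∀ k : ℕ, C ((A ^ k) x) = 0) → x = 0) :
    ∃ K : F →L[ℝ] E, ∀ v : E,
      (fun t : ℝ => NormedSpace.exp (t • (A + K.comp C)) v) =O[atTop]
        fun t => Real.exp (-lam * t) := by
  have : CompleteSpace E := FiniteDimensional.complete ℝ E
  have : CompleteSpace F := FiniteDimensional.complete ℝ F
  set B : E →L[ℝ] E := -(A + lam • 1) with hB
  have hexp : ∀ r : ℝ, HasDerivAt (fun u : ℝ => NormedSpace.exp (u • B))
      (NormedSpace.exp (r • B) * B) r := fun r => hasDerivAt_exp_smul_const B r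
  have hScont : Continuous fun u : ℝ => NormedSpace.exp (u • B) :=
    continuous_iff_continuousAt.2 fun r => (hexp r).continuousAt
  set T : ℝ → E →L[ℝ] F := fun s => C.comp (NormedSpace.exp (s • B)) with hT
  have hTcont : Continuous T := continuous_const.clm_comp hScont
  have hT' : ∀ s x, HasDerivAt (fun u => T u x) (T s (B x)) s := fun s x => by
    have := C.hasFDerivAt.comp_hasDerivAt s ((hexp s).clm_apply (hasDerivAt_const s x))
    simpa [hT, Function.comp_def] using this
  have hT0 : ∀ x, T 0 x = C x := fun x => by simp [hT]
  set W : E →L[ℝ] E := ∫ s in (0 : ℝ)..1, (ContinuousLinearMap.adjoint (T s)).comp (T s) with hW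
  have hWint : ∀ x y, inner ℝ x (W y) = ∫ s in (0 : ℝ)..1, inner ℝ (T s x) (T s y) := by
    intro x y
    have hc : Continuous fun s => (ContinuousLinearMap.adjoint (T s)).comp (T s) :=
      (ContinuousLinearMap.adjoint.continuous.comp hTcont).clm_comp hTcont
    have := ((innerSL ℝ x).comp (ContinuousLinearMap.apply ℝ E y)).intervalIntegral_comp_comm
      (hc.intervalIntegrable (μ := MeasureTheory.volume) 0 1)
    rw [← hW] at this
    simpa [ContinuousLinearMap.adjoint_inner_right] using this.symm
  have hsymm : ∀ x y, inner ℝ (W x) y = inner ℝ x (W y) := fun x y => by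
    rw [real_inner_comm, hWint, hWint]
    simp only [real_inner_comm]
  -- Lyapunov identity: the left side is the integral over the unit interval of the derivative of
  -- `‖T s x‖ ^ 2`.
  have hLyap : ∀ x, 2 * inner ℝ x (W (B x)) = ‖T 1 x‖ ^ 2 - ‖C x‖ ^ 2 := fun x => by
    have hx : Continuous fun s => T s x := hTcont.clm_apply continuous_const
    have hBx : Continuous fun s => T s (B x) := hTcont.clm_apply continuous_const
    have := intervalIntegral.integral_eq_sub_of_hasDerivAt (a := 0) (b := 1)
      (fun s _ => (hT' s x).norm_sq)
      ((continuous_const.mul (hx.inner hBx)).intervalIntegrable 0 1)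
    rw [hT0] at this
    rw [← this, hWint, intervalIntegral.integral_const_mul]
  have hpos : ∀ x ∈ (⊤ : Submodule ℝ E), x ≠ 0 → 0 < inner ℝ x (W x) := by
    intro x _ hx0
    rw [hWint]
    have hx : Continuous fun s => inner ℝ (T s x) (T s x) :=
      (hTcont.clm_apply continuous_const).inner (hTcont.clm_apply continuous_const)
    have hnn : 0 ≤ ∫ s in (0 : ℝ)..1, inner ℝ (T s x) (T s x) :=
      intervalIntegral.integral_nonneg zero_le_one fun s _ => real_inner_self_nonneg
    refine lt_of_le_of_ne hnn fun h => hx0 ?_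
    have hzero : ∀ s ∈ Set.Ioo (0 : ℝ) 1, T s x = 0 := fun s hs => by
      by_contra hne
      refine (intervalIntegral.integral_pos zero_lt_one hx.continuousOn
        (fun s _ => real_inner_self_nonneg) ⟨s, ⟨hs.1.le, hs.2.le⟩, ?_⟩).ne h
      exact real_inner_self_pos.2 hne
    -- Differentiating `T s x = 0` repeatedly in `s` brings down powers of `B`.
    have hpow : ∀ k : ℕ, ∀ s ∈ Set.Ioo (0 : ℝ) 1, T s ((B ^ k) x) = 0 := by
      intro k
      induction k with
      | zero => simpa using hzero
      | succ k ih =>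
        intro s hs
        have h1 := hT' s ((B ^ k) x)
        have h2 : HasDerivAt (fun u => T u ((B ^ k) x)) 0 s :=
          (hasDerivAt_const s (0 : F)).congr_of_eventuallyEq
            (eventually_of_mem (Ioo_mem_nhds hs.1 hs.2) ih)
        rw [pow_succ', mul_apply_eq_comp]
        exact h1.unique h2
    -- Powers of `A = -B - lam` inherit the vanishing; `2⁻¹` is just an interior time. Commuting `A
    -- ^ k` past the exponential then makes `exp (B / 2) x` unobservable, hence zero, and the
    -- exponential is invertible.
    have hB' : ∀ k : ℕ, ∀ y, (∀ j : ℕ, T 2⁻¹ ((B ^ j) y) = 0) → T 2⁻¹ ((A ^ k) y) = 0 := by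
      intro k
      induction k with
      | zero => intro y hy; simpa using hy 0
      | succ k ih =>
        intro y hy
        have hA : A y = -B y - lam • y := by simp [hB]
        rw [pow_succ, mul_apply_eq_comp, hA, map_sub, map_sub, map_neg, map_neg, map_smul,
          map_smul, ih y hy, ih (B y) fun j => ?_]
        · simp
        · rw [← mul_apply_eq_comp, ← pow_succ]
          exact hy _
    have hcomm : ∀ k : ℕ, Commute (A ^ k) (NormedSpace.exp ((2⁻¹ : ℝ) • B)) := fun k => by
      have : Commute A B := by
        rw [hB]
        exact ((Commute.refl A).add_right ((Commute.one_right A).smul_right lam)).neg_right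
      exact ((this.smul_right (2⁻¹ : ℝ)).exp_right).pow_left k
    have hS0 : NormedSpace.exp ((2⁻¹ : ℝ) • B) x = 0 := hobs _ fun k => by
      rw [← mul_apply_eq_comp, (hcomm k).eq]
      exact hB' k x fun j => hpow j _ (by norm_num)
    have hinv : NormedSpace.exp (-(2⁻¹ : ℝ) • B) * NormedSpace.exp ((2⁻¹ : ℝ) • B) = 1 := by
      let _ : NormedAlgebra ℚ (E →L[ℝ] E) := NormedAlgebra.restrictScalars ℚ ℝ _
      rw [← NormedSpace.exp_add_of_commute
        ((Commute.refl B).smul_left (-(2⁻¹ : ℝ)) |>.smul_right (2⁻¹ : ℝ))]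
      simp
    have := congrArg (fun U : E →L[ℝ] E => U x) hinv
    simpa [hS0] using this.symm
  obtain ⟨c, hc, hcW⟩ := exists_pos_mul_norm_sq_le (fun x : E => inner ℝ x (W x))
    (by fun_prop) (fun r z => by
      simp only [map_smul, real_inner_smul_left, real_inner_smul_right]; ring) ⊤ hpos
  have hinj : Function.Injective (W : E →ₗ[ℝ] E) := by
    rw [← LinearMap.ker_eq_bot, LinearMap.ker_eq_bot']
    intro x hx
    by_contra hx0
    have h := hpos x trivial hx0
    rw [show W x = 0 from hx, inner_zero_right] at h
    exact lt_irrefl _ h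
  obtain ⟨Wi, hWi⟩ := (W : E →ₗ[ℝ] E).exists_rightInverse_of_surjective
    (LinearMap.range_eq_top.2 (LinearMap.injective_iff_surjective.1 hinj))
  have hWWi : ∀ y, W (Wi y) = y := fun y => congrArg (fun U : E →ₗ[ℝ] E => U y) hWi
  -- With `K = -W⁻¹ C*`, the derivative of `⟨X, W X⟩` is `-2 lam ⟨X, W X⟩ - ‖T 1 X‖² - ‖C X‖²` by
  -- `hLyap`.
  refine ⟨-(Wi.toContinuousLinearMap.comp (ContinuousLinearMap.adjoint C)), fun v => ?_⟩
  set M : E →L[ℝ] E := A + (-(Wi.toContinuousLinearMap.comp (ContinuousLinearMap.adjoint C))).comp C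
    with hM
  set X : ℝ → E := fun t => NormedSpace.exp (t • M) v with hX
  have hX' : ∀ t, HasDerivAt X (M (X t)) t := fun t => by
    have := (hasDerivAt_exp_smul_const' M t).clm_apply (hasDerivAt_const t v)
    simpa [hX] using this
  have hXc : Continuous X := continuous_iff_continuousAt.2 fun t => (hX' t).continuousAt
  have hf' : ∀ t, HasDerivAt (fun t => inner ℝ (X t) (W (X t)))
      (2 * inner ℝ (X t) (W (M (X t)))) t := fun t => by
    have := (hX' t).inner ℝ (W.hasFDerivAt.comp_hasDerivAt t (hX' t))
    refine this.congr_deriv ?_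
    rw [Function.comp_apply, real_inner_comm, hsymm]
    ring
  have hdecay : ∀ t, 0 ≤ t →
      inner ℝ (X t) (W (X t)) ≤ Real.exp (-(2 * lam) * t) * inner ℝ (X 0) (W (X 0)) := by
    intro t ht
    have := le_of_hasDerivAt_le_neg_mul_sub (f := fun t => inner ℝ (X t) (W (X t)))
      (γ := 2 * lam) (d := 0) ht le_rfl (hXc.inner (W.continuous.comp hXc)).continuousOn
      (fun r _ => hf' r) (fun r _ => ?_)
    · simpa using this
    · have h1 := hLyap (X r)
      have h2 : W (M (X r)) = -W (B (X r)) - lam • W (X r) -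
          ContinuousLinearMap.adjoint C (C (X r)) := by
        simp [hM, hB, hWWi]
        abel
      have h3 : 0 ≤ ‖T 1 (X r)‖ ^ 2 := sq_nonneg _
      have h4 : 0 ≤ ‖C (X r)‖ ^ 2 := sq_nonneg _
      rw [h2, inner_sub_right, inner_sub_right, inner_neg_right, real_inner_smul_right,
        ContinuousLinearMap.adjoint_inner_right, real_inner_self_eq_norm_sq]
      linarith
  refine IsBigO.of_bound (Real.sqrt (c⁻¹ * inner ℝ (X 0) (W (X 0)))) ?_
  filter_upwards [eventually_ge_atTop 0] with t ht
  have h0 : 0 ≤ inner ℝ (X 0) (W (X 0)) :=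
    (mul_nonneg hc.le (sq_nonneg _)).trans (hcW (X 0) trivial)
  rw [Real.norm_of_nonneg (Real.exp_pos _).le]
  refine abs_le_of_sq_le_sq' ?_ (by positivity) |>.2
  rw [mul_pow, Real.sq_sqrt (by positivity), ← Real.exp_nat_mul]
  have h1 := (hcW (X t) trivial).trans (hdecay t ht)
  have h2 : ‖X t‖ ^ 2 = c⁻¹ * (c * ‖X t‖ ^ 2) := by field_simp
  change ‖X t‖ ^ 2 ≤ _
  rw [h2]
  calc c⁻¹ * (c * ‖X t‖ ^ 2) ≤ c⁻¹ * (Real.exp (-(2 * lam) * t) * inner ℝ (X 0) (W (X 0))) := by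
        gcongr
    _ = _ := by
        rw [show ((2 : ℕ) : ℝ) * (-lam * t) = -(2 * lam) * t by push_cast; ring]
        ring

/-! ### Unobservable spaces and admissible gains -/

/-- By Cayley–Hamilton, `X ^ k` may be reduced modulo the characteristic polynomial to degree below
`n`. The case `n = 0` is separate, as that polynomial is then 1. -/
theorem mem_unobservableSpace {n : ℕ} {p : Type*} [Fintype p] {C : Matrix p (Fin n) ℝ}
    {A : Matrix (Fin n) (Fin n) ℝ} {x : EuclideanSpace ℝ (Fin n)} :
    x ∈ unobservableSpace C A ↔ ∀ k : ℕ, Matrix.toEuclideanLin (C * A ^ k) x = 0 := by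
  have hlt : x ∈ unobservableSpace C A ↔ ∀ k < n, (C * A ^ k) *ᵥ x.ofLp = 0 := by
    rw [unobservableSpace, LinearMap.mem_ker]
    constructor
    · intro h k hk
      ext a
      exact congrArg (fun v : EuclideanSpace ℝ (Fin n × p) => v (⟨k, hk⟩, a)) h
    · intro h
      ext ⟨k, a⟩
      exact congrFun (h k k.2) a
  have hiff : ∀ k, Matrix.toEuclideanLin (C * A ^ k) x = 0 ↔ (C * A ^ k) *ᵥ x.ofLp = 0 :=
    fun k => by rw [Matrix.toLpLin_apply, WithLp.toLp_eq_zero]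
  simp only [hiff]
  rw [hlt]
  refine ⟨fun h k => ?_, fun h k _ => h k⟩
  rcases Nat.eq_zero_or_pos n with rfl | hn
  · rw [Subsingleton.elim x.ofLp 0, Matrix.mulVec_zero]
  have hne : A.charpoly ≠ 1 := fun h1 => by
    have := A.charpoly_natDegree_eq_dim
    rw [h1] at this
    simp at this
    omega
  have hdeg := Polynomial.natDegree_modByMonic_lt (Polynomial.X ^ k) A.charpoly_monic hne
  rw [A.charpoly_natDegree_eq_dim, Fintype.card_fin] at hdeg
  rw [Matrix.pow_eq_aeval_mod_charpoly, Polynomial.aeval_eq_sum_range' hdeg, Matrix.mul_sum,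
    Matrix.sum_mulVec]
  refine Finset.sum_eq_zero fun i hi => ?_
  rw [Matrix.mul_smul, Matrix.smul_mulVec, h i (Finset.mem_range.1 hi), smul_zero]

theorem toEuclideanLin_mul_apply {n : ℕ} {p q : Type*} [Fintype q] [DecidableEq q]
    (M : Matrix p q ℝ) (M' : Matrix q (Fin n) ℝ) (x : EuclideanSpace ℝ (Fin n)) :
    Matrix.toEuclideanLin (M * M') x = Matrix.toEuclideanLin M (Matrix.toEuclideanLin M' x) := by
  simp [Matrix.toLpLin_apply, Matrix.mulVec_mulVec]

theorem map_mem_unobservableSpace {n : ℕ} {p : Type*} [Fintype p] {C : Matrix p (Fin n) ℝ}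
    {A : Matrix (Fin n) (Fin n) ℝ} {x : EuclideanSpace ℝ (Fin n)}
    (hx : x ∈ unobservableSpace C A) : Matrix.toEuclideanLin A x ∈ unobservableSpace C A := by
  rw [mem_unobservableSpace] at hx ⊢
  intro k
  rw [← toEuclideanLin_mul_apply, Matrix.mul_assoc, ← pow_succ]
  exact hx _

theorem toEuclideanLin_eq_zero_of_mem_unobservableSpace {n : ℕ} {p : Type*} [Fintype p]
    {C : Matrix p (Fin n) ℝ} {A : Matrix (Fin n) (Fin n) ℝ} {x : EuclideanSpace ℝ (Fin n)}
    (hx : x ∈ unobservableSpace C A) : Matrix.toEuclideanLin C x = 0 := by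
  simpa using mem_unobservableSpace.1 hx 0

/-- Admissible gains exist. -/
theorem exists_isLocalGain {n p : ℕ} (C : Matrix (Fin p) (Fin n) ℝ)
    (A : Matrix (Fin n) (Fin n) ℝ) (lam : ℝ) : ∃ K, IsLocalGain C A lam K := by
  set V := unobservableSpace C A with hV
  set r := Module.finrank ℝ Vᗮ
  set b := stdOrthonormalBasis ℝ Vᗮ
  -- `Q` gives orthonormal coordinates of the projection on `Vᗮ` and `R` includes `Vᗮ` back; the
  -- reduced pair is `(C * R, Q * A * R)`.
  set Q : Matrix (Fin r) (Fin n) ℝ := Matrix.toEuclideanLin.symm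
    (b.repr.toLinearEquiv.toLinearMap ∘ₗ (Vᗮ.orthogonalProjectionOnto : _ →ₗ[ℝ] Vᗮ)) with hQ
  set R : Matrix (Fin n) (Fin r) ℝ := Matrix.toEuclideanLin.symm
    (Vᗮ.subtype ∘ₗ b.repr.symm.toLinearEquiv.toLinearMap) with hR
  have hQx : ∀ x, Matrix.toEuclideanLin Q x = b.repr (Vᗮ.orthogonalProjectionOnto x) := fun x => by
    rw [hQ, LinearEquiv.apply_symm_apply]
    rfl
  have hRx : ∀ x, Matrix.toEuclideanLin R x = b.repr.symm x := fun x => by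
    rw [hR, LinearEquiv.apply_symm_apply]
    rfl
  have hQR : Q * R = 1 := by
    apply Matrix.toEuclideanLin.injective
    ext1 x
    rw [toEuclideanLin_mul_apply, hQx, hRx, Submodule.orthogonalProjectionOnto_mem_subspace_eq_self,
      LinearIsometryEquiv.apply_symm_apply]
    simp
  have hker : LinearMap.ker (Matrix.toEuclideanLin Q) = V := by
    ext x
    rw [LinearMap.mem_ker, hQx, map_eq_zero_iff _ b.repr.injective,
      Submodule.orthogonalProjectionOnto_eq_zero_iff, Submodule.orthogonal_orthogonal]
  have hdiff : ∀ x, x - Matrix.toEuclideanLin R (Matrix.toEuclideanLin Q x) ∈ V := fun x => by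
    rw [← hker, LinearMap.mem_ker, map_sub, ← toEuclideanLin_mul_apply Q R, hQR]
    simp
  have hrank : Q.rank = r := by
    refine le_antisymm (by simpa using Q.rank_le_card_height) ?_
    have := Matrix.rank_mul_le_left Q R
    rwa [hQR, Matrix.rank_one, Fintype.card_fin] at this
  have hCQ : C * R * Q = C := by
    apply Matrix.toEuclideanLin.injective
    ext1 x
    have := toEuclideanLin_eq_zero_of_mem_unobservableSpace (hdiff x)
    rw [map_sub, sub_eq_zero] at this
    rw [toEuclideanLin_mul_apply, toEuclideanLin_mul_apply, this]
  have hQA : Q * A = Q * A * R * Q := by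
    apply Matrix.toEuclideanLin.injective
    ext1 x
    have := map_mem_unobservableSpace (hdiff x)
    rw [← hV, ← hker, LinearMap.mem_ker, map_sub, map_sub, sub_eq_zero] at this
    simp only [toEuclideanLin_mul_apply, this]
  -- This transfers observability: if `x` is unobservable for the reduced pair, then `R x` lies in
  -- `V`, the kernel of `Q`, so `x = Q R x = 0`.
  have hpow : ∀ k : ℕ, C * R * (Q * A * R) ^ k * Q = C * A ^ k := by
    intro k
    induction k with
    | zero => simp [hCQ]
    | succ k ih =>
      rw [pow_succ, ← Matrix.mul_assoc, Matrix.mul_assoc _ _ Q, ← hQA, ← Matrix.mul_assoc, ih,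
        pow_succ, Matrix.mul_assoc]
  obtain ⟨K, hK⟩ := exists_outputInjection (Matrix.toEuclideanCLM (𝕜 := ℝ) (Q * A * R))
    (Matrix.toEuclideanLin (C * R)).toContinuousLinearMap lam (fun x hx => by
      have hRV : Matrix.toEuclideanLin R x ∈ V := mem_unobservableSpace.2 fun k => by
        rw [← hpow, ← toEuclideanLin_mul_apply, Matrix.mul_assoc, hQR, Matrix.mul_one,
          toEuclideanLin_mul_apply]
        have := hx k
        rw [← map_pow] at this
        exact this
      rw [← hker, LinearMap.mem_ker, ← toEuclideanLin_mul_apply, hQR] at hRV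
      simpa using hRV)
  set Kb : Matrix (Fin r) (Fin p) ℝ := Matrix.toEuclideanLin.symm (K : _ →ₗ[ℝ] _) with hKb
  refine ⟨R * Kb, r, Q, C * R, Q * A * R, Kb, R, hrank, hker, hCQ, hQA, ?_, hQR, rfl⟩
  rw [expDecaysAtRate_iff]
  have hKC : Matrix.toEuclideanCLM (𝕜 := ℝ) (Kb * (C * R)) =
      K.comp (Matrix.toEuclideanLin (C * R)).toContinuousLinearMap := by
    ext1 x
    change Matrix.toEuclideanLin (Kb * (C * R)) x = _
    rw [toEuclideanLin_mul_apply, hKb, LinearEquiv.apply_symm_apply]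
    rfl
  rw [map_add, hKC]
  exact hK

/-- With an admissible gain, the component of the estimation error orthogonal to the unobservable
space decays at rate `lam`, whatever enters through the unobservable space. -/
theorem IsLocalGain.exists_bound {n p : ℕ} {C : Matrix (Fin p) (Fin n) ℝ}
    {A : Matrix (Fin n) (Fin n) ℝ} {lam : ℝ} {K : Matrix (Fin n) (Fin p) ℝ}
    (hK : IsLocalGain C A lam K) {D : Set ℝ} (hD : D.Countable)
    {e v : ℝ → EuclideanSpace ℝ (Fin n)} (hv : ∀ t, v t ∈ unobservableSpace C A)
    (he : ContinuousOn e (Set.Ici 0))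
    (he' : ∀ t, 0 < t → t ∉ D → HasDerivAt e (Matrix.toEuclideanLin (A + K * C) (e t) + v t) t) :
    ∃ c, 0 ≤ c ∧ ∀ t, 0 ≤ t →
      ‖e t - (unobservableSpace C A).starProjection (e t)‖ ≤ c * Real.exp (-lam * t) := by
  obtain ⟨r, Q, Cb, Ab, Kb, R, -, hker, hC, hA, hdec, hQR, rfl⟩ := hK
  set V := unobservableSpace C A
  set Q' := (Matrix.toEuclideanLin Q).toContinuousLinearMap
  set M := Matrix.toEuclideanCLM (𝕜 := ℝ) (Ab + Kb * Cb)
  -- Since `Q` also kills `v`, this gives `Q e` an autonomous equation.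
  have hQM : Q * (A + R * Kb * C) = (Ab + Kb * Cb) * Q := by
    rw [Matrix.mul_add, Matrix.add_mul, hA, ← Matrix.mul_assoc, ← Matrix.mul_assoc, hQR,
      Matrix.one_mul, Matrix.mul_assoc Kb, hC]
  have hq : ContinuousOn (fun t => Q' (e t)) (Set.Ici 0) := Q'.continuous.comp_continuousOn he
  have hq' : ∀ t, 0 < t → t ∉ D → HasDerivAt (fun t => Q' (e t)) (M (Q' (e t))) t := by
    intro t ht htD
    have h := Q'.hasFDerivAt.comp_hasDerivAt t (he' t ht htD)
    have hv0 : Q' (v t) = 0 := by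
      have := hv t
      rwa [← hker, LinearMap.mem_ker] at this
    rw [map_add, hv0, add_zero] at h
    refine h.congr_deriv ?_
    change Matrix.toEuclideanLin Q (Matrix.toEuclideanLin (A + R * Kb * C) (e t)) =
      Matrix.toEuclideanLin (Ab + Kb * Cb) (Matrix.toEuclideanLin Q (e t))
    rw [← toEuclideanLin_mul_apply, ← toEuclideanLin_mul_apply, hQM]
  have hbig : (fun t => Q' (e t)) =O[atTop] fun t => Real.exp (-lam * t) := by
    refine ((expDecaysAtRate_iff _ _).1 hdec (Q' (e 0))).congr' ?_ EventuallyEq.rfl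
    filter_upwards [eventually_ge_atTop 0] with t ht
    exact (eq_exp_smul_apply M hD hq hq' ht).symm
  obtain ⟨c, hc, hbound⟩ := exists_bound_of_isBigO_exp hq hbig
  -- `x - R Q x` lies in `V`, so the part of `x` orthogonal to `V` is a function of `Q x` alone.
  set T := (ContinuousLinearMap.id ℝ _ - V.starProjection).comp
    (Matrix.toEuclideanLin R).toContinuousLinearMap
  have hT : ∀ x, x - V.starProjection x = T (Q' x) := fun x => by
    have hmem : x - Matrix.toEuclideanLin R (Matrix.toEuclideanLin Q x) ∈ V := by
      rw [← hker, LinearMap.mem_ker, map_sub, ← toEuclideanLin_mul_apply Q R, hQR]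
      simp
    have := Submodule.starProjection_eq_self_iff.2 hmem
    rw [map_sub] at this
    change _ = Matrix.toEuclideanLin R (Matrix.toEuclideanLin Q x) -
      V.starProjection (Matrix.toEuclideanLin R (Matrix.toEuclideanLin Q x))
    rw [sub_eq_sub_iff_sub_eq_sub, ← this]
  refine ⟨‖T‖ * c, by positivity, fun t ht => ?_⟩
  rw [hT, mul_assoc]
  exact (T.le_opNorm _).trans (by gcongr; exact hbound t ht)

/-! ### Error equations and conclusion -/

theorem countable_discontinuities {m : ℕ} {τD δ₀ : ℝ} {N : ℝ → Digraph (Fin m)}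
    (hN : IsAvgDwellNeighborGraph τD δ₀ N) : {t | 0 < t ∧ IsDiscontinuity N t}.Countable := by
  have : {t | 0 < t ∧ IsDiscontinuity N t} ⊆ ⋃ k : ℕ, discontinuities N 0 k := fun t ht => by
    obtain ⟨k, hk⟩ := exists_nat_gt t
    exact Set.mem_iUnion.2 ⟨k, ⟨ht.1, hk⟩, ht.2⟩
  exact (Set.countable_iUnion fun k : ℕ =>
    (hN.2 0 k le_rfl k.cast_nonneg).1.countable).mono this

/-- Joint observability: the unobservable spaces have trivial intersection. -/
theorem IsJointlyObservable.eq_zero {m n : ℕ} {s : Fin m → ℕ}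
    {C : ∀ i, Matrix (Fin (s i)) (Fin n) ℝ} {A : Matrix (Fin n) (Fin n) ℝ}
    (h : IsJointlyObservable C A) {x : EuclideanSpace ℝ (Fin n)}
    (hx : ∀ i, x ∈ unobservableSpace (C i) A) : x = 0 := by
  have hxs : observabilityMatrix (stack C) A *ᵥ x.ofLp = 0 := by
    ext ⟨k, i, a⟩
    have := mem_unobservableSpace.1 (hx i) k
    exact congrArg (fun v : EuclideanSpace ℝ (Fin (s i)) => v a) this
  have hker : LinearMap.ker (observabilityMatrix (stack C) A).mulVecLin = ⊥ := by
    have h1 := LinearMap.finrank_range_add_finrank_ker (observabilityMatrix (stack C) A).mulVecLin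
    have h2 : Module.finrank ℝ (LinearMap.range (observabilityMatrix (stack C) A).mulVecLin) = n :=
      h
    rw [h2, Module.finrank_fin_fun] at h1
    exact Submodule.finrank_eq_zero.1 (by omega)
  have : x.ofLp ∈ LinearMap.ker (observabilityMatrix (stack C) A).mulVecLin := hxs
  rw [hker, Submodule.mem_bot] at this
  exact (WithLp.ofLp_eq_zero 2).1 this

/-- Averages reproduce constants, so the plant state cancels from the coupling; self-arcs keep the
neighbor set nonempty. -/
theorem sub_average_sub {ι E : Type*} [AddCommGroup E] [Module ℝ E] (S : Finset ι)
    (hS : S.Nonempty) (f : ι → E) (x y : E) :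
    y - x - (S.card : ℝ)⁻¹ • ∑ j ∈ S, (f j - x) = y - (S.card : ℝ)⁻¹ • ∑ j ∈ S, f j := by
  have : (S.card : ℝ) ≠ 0 := by exact_mod_cast hS.card_ne_zero
  rw [Finset.sum_sub_distrib, Finset.sum_const, ← Nat.cast_smul_eq_nsmul ℝ, smul_sub, smul_smul,
    inv_mul_cancel₀ this, one_smul]
  abel

theorem norm_average_le {ι E : Type*} [NormedAddCommGroup E] [NormedSpace ℝ E] (S : Finset ι)
    (hS : S.Nonempty) (f : ι → E) {c : ℝ} (hf : ∀ j ∈ S, ‖f j‖ ≤ c) :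
    ‖(S.card : ℝ)⁻¹ • ∑ j ∈ S, f j‖ ≤ c := by
  have : 0 < (S.card : ℝ) := by exact_mod_cast hS.card_pos
  rw [norm_smul, norm_inv, Real.norm_of_nonneg this.le, inv_mul_le_iff₀ this, ← nsmul_eq_mul]
  exact (norm_sum_le_of_le S hf).trans_eq (Finset.sum_const c)

/-- The equations of the estimation errors. -/
theorem IsEstimatorTrajectory.hasDerivAt_error {m n : ℕ} {s : Fin m → ℕ}
    {A : Matrix (Fin n) (Fin n) ℝ} {C : ∀ i, Matrix (Fin (s i)) (Fin n) ℝ}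
    {K : ∀ i, Matrix (Fin n) (Fin (s i)) ℝ} {g : ℝ} {N : ℝ → Digraph (Fin m)}
    {x : ℝ → EuclideanSpace ℝ (Fin n)} {xh : Fin m → ℝ → EuclideanSpace ℝ (Fin n)}
    (hx : IsPlantTrajectory A x)
    (hxh : IsEstimatorTrajectory A C K g N (fun i t => Matrix.toEuclideanLin (C i) (x t)) xh)
    (i : Fin m) {t : ℝ} (ht : 0 < t) (hNt : ¬ IsDiscontinuity N t)
    (hself : (N t).Adj i i) :
    HasDerivAt (fun t => xh i t - x t)
      (Matrix.toEuclideanLin (A + K i * C i) (xh i t - x t) +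
        -(g • (unobservableSpace (C i) A).starProjection (xh i t - x t -
          ((neighbors (N t) i).card : ℝ)⁻¹ • ∑ j ∈ neighbors (N t) i, (xh j t - x t)))) t := by
  refine (((hxh i).2 t ht hNt).sub (hx.2 t ht)).congr_deriv ?_
  rw [sub_average_sub _ ⟨i, mem_neighbors.2 hself⟩,
    map_sub (Matrix.toEuclideanLin (A + K i * C i))]
  have : Matrix.toEuclideanLin (A + K i * C i) (x t) =
      Matrix.toEuclideanLin A (x t) +
        Matrix.toEuclideanLin (K i) (Matrix.toEuclideanLin (C i) (x t)) := by
    rw [map_add, LinearMap.add_apply, toEuclideanLin_mul_apply]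
  rw [this]
  abel

end DistEst

theorem theorem2 {m n : ℕ} {s : Fin m → ℕ}
    (A : Matrix (Fin n) (Fin n) ℝ) (C : ∀ i, Matrix (Fin (s i)) (Fin n) ℝ)
    (hobs : DistEst.IsJointlyObservable C A)
    (τD lam : ℝ) (hτD : 0 < τD) (hlam : 0 < lam) :
    (∃ K : ∀ i, Matrix (Fin n) (Fin (s i)) ℝ,
      ∀ i, DistEst.IsLocalGain (C i) A lam (K i)) ∧
    ∃ gstar : ℝ, 0 < gstar ∧
      ∀ g : ℝ, gstar ≤ g →
      ∀ (δ₀ : ℝ) (N : ℝ → Digraph (Fin m)), DistEst.IsAvgDwellNeighborGraph τD δ₀ N →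
      ∀ K : ∀ i, Matrix (Fin n) (Fin (s i)) ℝ,
        (∀ i, DistEst.IsLocalGain (C i) A lam (K i)) →
        ∀ (x : ℝ → EuclideanSpace ℝ (Fin n)) (xh : Fin m → ℝ → EuclideanSpace ℝ (Fin n)),
          DistEst.IsPlantTrajectory A x →
          DistEst.IsEstimatorTrajectory A C K g N
            (fun i t => Matrix.toEuclideanLin (C i) (x t)) xh →
          ∀ i, (fun t => xh i t - x t) =O[atTop] fun t => Real.exp (-lam * t) := by
  open DistEst in
  refine ⟨⟨fun i => (exists_isLocalGain (C i) A lam).choose,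
    fun i => (exists_isLocalGain (C i) A lam).choose_spec⟩, ?_⟩
  set V := fun i => unobservableSpace (C i) A with hVdef
  obtain ⟨κ, c, hκ, hc, hcoer⟩ := exists_uniform_laplacian_coercive V fun x hx => hobs.eq_zero hx
  set ℓ := Real.log κ
  have hℓ : 0 ≤ ℓ := Real.log_nonneg hκ
  have hℓκ : Real.exp ℓ = κ := Real.exp_log (by linarith)
  set A' := Matrix.toEuclideanCLM (𝕜 := ℝ) A
  -- Rate for squared norms: `2 * lam` is wanted, `ℓ / τD` pays for switching, and 1 is the margin
  -- that absorbs the chatter.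
  set γ := ℓ / τD + 2 * lam + 1 with hγdef
  have hγ : 1 ≤ γ := by
    have : 0 ≤ ℓ / τD := by positivity
    linarith
  refine ⟨(γ + 2 * ‖A'‖ + 1) / (2 * c), by positivity,
    fun g hg δ₀ N hN K hK x xh hx hxh i₀ => ?_⟩
  have hgc : γ + 2 * ‖A'‖ + 1 ≤ 2 * g * c := by
    rw [div_le_iff₀ (by positivity)] at hg
    linarith
  have hg0 : 0 ≤ g := le_trans (by positivity) hg
  set e : Fin m → ℝ → EuclideanSpace ℝ (Fin n) := fun i t => xh i t - x t with he
  set avg : (Fin m → ℝ → EuclideanSpace ℝ (Fin n)) → Fin m → ℝ → EuclideanSpace ℝ (Fin n) :=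
    fun u i t => ((neighbors (N t) i).card : ℝ)⁻¹ • ∑ j ∈ neighbors (N t) i, u j t with havg
  set D := {t | 0 < t ∧ IsDiscontinuity N t}
  have hecont : ∀ i, ContinuousOn (e i) (Set.Ici 0) := fun i => (hxh i).1.sub hx.1
  have he' : ∀ i t, 0 < t → ¬ IsDiscontinuity N t → HasDerivAt (e i)
      (Matrix.toEuclideanLin (A + K i * C i) (e i t) +
        -(g • (V i).starProjection (e i t - avg e i t))) t := fun i t ht hNt =>
    hxh.hasDerivAt_error hx i ht hNt ((hN.1 t ht.le).1 i)
  have hmem : ∀ i y, (V i).starProjection y ∈ V i := fun i y =>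
    Submodule.starProjection_apply_mem _ _
  choose cw hcw0 hcw using fun i => (hK i).exists_bound (countable_discontinuities hN)
    (fun t => (V i).neg_mem ((V i).smul_mem g (hmem i (e i t - avg e i t))))
    (hecont i) (fun t ht htD => he' i t ht fun h => htD ⟨ht, h⟩)
  set z : Fin m → ℝ → EuclideanSpace ℝ (Fin n) := fun i t => (V i).starProjection (e i t) with hz
  set w : Fin m → ℝ → EuclideanSpace ℝ (Fin n) := fun i t => e i t - z i t with hw
  -- A neighbor average mixes the `w j`, so one constant bounding all of them is needed.
  set cs := ∑ i, cw i
  have hcs0 : 0 ≤ cs := Finset.sum_nonneg fun i _ => hcw0 i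
  have hwb : ∀ i t, 0 ≤ t → ‖w i t‖ ≤ cs * Real.exp (-lam * t) := fun i t ht =>
    (hcw i t ht).trans (mul_le_mul_of_nonneg_right
      (Finset.single_le_sum (fun j _ => hcw0 j) (Finset.mem_univ i)) (Real.exp_pos _).le)
  set T : Fin m → EuclideanSpace ℝ (Fin n) →L[ℝ] EuclideanSpace ℝ (Fin n) :=
    fun i => (Matrix.toEuclideanCLM (𝕜 := ℝ) (A + K i * C i))
  set b : Fin m → ℝ → EuclideanSpace ℝ (Fin n) := fun i t =>
    (V i).starProjection (T i (w i t) + g • avg w i t) with hb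
  have hzV : ∀ i t, z i t ∈ V i := fun i t => hmem i _
  have hz' : ∀ i t, 0 < t → ¬ IsDiscontinuity N t → HasDerivAt (z i)
      ((V i).starProjection (A' (z i t)) - g • (V i).starProjection (z i t - avg z i t) + b i t)
      t := by
    intro i t ht hNt
    refine ((V i).starProjection.hasFDerivAt.comp_hasDerivAt t (he' i t ht hNt)).congr_deriv ?_
    have hez : ∀ j, e j t = z j t + w j t := fun j => by simp [hw]
    -- `C i` vanishes on `z i t`, so the gain acts only on `w i t`.
    have hCz : Matrix.toEuclideanLin (A + K i * C i) (e i t) = A' (z i t) + T i (w i t) := by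
      have hAz : Matrix.toEuclideanLin (A + K i * C i) (z i t) = A' (z i t) := by
        rw [map_add, LinearMap.add_apply, toEuclideanLin_mul_apply,
          toEuclideanLin_eq_zero_of_mem_unobservableSpace (hzV i t), map_zero, add_zero]
        rfl
      rw [hez, map_add, hAz]
      rfl
    have hav : avg e i t = avg z i t + avg w i t := by
      simp only [havg, ← smul_add, ← Finset.sum_add_distrib, hez]
    have hPw : (V i).starProjection (w i t) = 0 := by
      simp only [hw, map_sub]
      rw [Submodule.starProjection_eq_self_iff.2 (hzV i t), sub_self]
    have hPP : ∀ y, (V i).starProjection ((V i).starProjection y) = (V i).starProjection y :=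
      fun y => Submodule.starProjection_eq_self_iff.2 (hmem i y)
    rw [hCz, hav, hez i]
    simp only [hb, map_add, map_sub, map_neg, map_smul, hPP, hPw, add_zero]
    module
  have hbb : ∀ i t, 0 ≤ t → ‖b i t‖ ≤ (‖T i‖ + g) * cs * Real.exp (-lam * t) := by
    intro i t ht
    calc ‖b i t‖ ≤ ‖T i (w i t) + g • avg w i t‖ := Submodule.norm_starProjection_apply_le _ _
      _ ≤ ‖T i‖ * (cs * Real.exp (-lam * t)) + g * (cs * Real.exp (-lam * t)) := by
        refine (norm_add_le _ _).trans (add_le_add ?_ ?_)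
        · exact (T i).le_opNorm_of_le (hwb i t ht)
        · rw [norm_smul, Real.norm_of_nonneg hg0]
          refine mul_le_mul_of_nonneg_left (norm_average_le _
            ⟨i, mem_neighbors.2 ((hN.1 t ht).1 i)⟩ _ fun j _ => hwb j t ht) hg0
      _ = _ := by ring
  set B := ∑ i, ((‖T i‖ + g) * cs) ^ 2
  have hB : 0 ≤ B := Finset.sum_nonneg fun i _ => sq_nonneg _
  have hbsum : ∀ t, 0 ≤ t → ∑ i, ‖b i t‖ ^ 2 ≤ B * Real.exp (-(2 * lam) * t) := by
    intro t ht
    rw [Finset.sum_mul]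
    refine Finset.sum_le_sum fun i _ => ?_
    have hE : Real.exp (-(2 * lam) * t) = Real.exp (-lam * t) ^ 2 := by
      rw [← Real.exp_nat_mul]; push_cast; ring_nf
    rw [hE, ← mul_pow]
    exact pow_le_pow_left₀ (norm_nonneg _) (hbb i t ht) 2
  have hmain := isBigO_of_switching (N := N) (W := fun t => ∑ i, ‖z i t‖ ^ 2) (B := B)
    (μ := 2 * lam) hℓ hB (by positivity) hτD
    (fun t => Finset.sum_nonneg fun i _ => sq_nonneg _) hN (fun s t hs hst hdisc => by
      -- The graph is sampled at the midpoint because its values at `s` and `t` may differ from the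
      -- one between.
      obtain ⟨p, hp, hpκ, hpc⟩ := hcoer (N ((s + t) / 2)) (hN.1 _ (by linarith))
      have hconst : ∀ r ∈ Set.Ioo s t, N r = N ((s + t) / 2) := fun r hr =>
        eq_of_discontinuities_eq_empty hdisc hr ⟨by linarith [hr.1, hr.2], by linarith [hr.1, hr.2]⟩
      rw [hℓκ]
      refine sum_norm_sq_le_of_constant_graph V A' hg0 hγ hgc (by positivity) hp hpκ hκ hpc hzV hst
        (b := b) (fun i => (V i).starProjection.continuous.comp_continuousOn
          ((hecont i).mono fun r hr => hs.trans hr.1)) (fun i r hr => ?_) (fun r hr => ?_)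
      · have h := hz' i r (hs.trans_lt hr.1) fun h => by
          have : r ∈ discontinuities N s t := ⟨hr, h⟩
          simp [hdisc] at this
        simpa only [havg, hconst r hr] using h
      · refine (hbsum r (hs.trans hr.1.le)).trans ?_
        gcongr B * Real.exp ?_
        nlinarith [hr.1])
  have hzO : z i₀ =O[atTop] fun t => Real.exp (-lam * t) := by
    have hsq : (fun t => ‖z i₀ t‖ ^ 2) =O[atTop] fun t => Real.exp (-lam * t) ^ 2 := by
      refine (IsBigO.of_norm_le fun t => ?_).trans (hmain.congr_right fun t => ?_)
      · rw [Real.norm_of_nonneg (sq_nonneg _)]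
        exact Finset.single_le_sum (f := fun i => ‖z i t‖ ^ 2) (fun j _ => sq_nonneg _)
          (Finset.mem_univ i₀)
      · rw [← Real.exp_nat_mul]; push_cast; ring_nf
    exact (IsBigO.of_pow (f := fun t => ‖z i₀ t‖) two_ne_zero hsq).of_norm_left
  have hwO : w i₀ =O[atTop] fun t => Real.exp (-lam * t) := by
    refine IsBigO.of_bound cs ?_
    filter_upwards [eventually_ge_atTop 0] with t ht
    rw [Real.norm_of_nonneg (Real.exp_pos _).le]
    exact hwb i₀ t ht
  exact (hzO.add hwO).congr_left fun t => add_sub_cancel (z i₀ t) (e i₀ t)
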